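/- Let $U\subseteq\mathbb C^2$ be open with coordinates $(x,y)$, and let $0\le\Delta\le n$ and $k\ge 0$ be integers. For $m\in\mathbb Z_{\ge0}$ let $\mathcal T_m$ be the span of the monomials $x^iy^j$ with $i,j\ge 0$, $i+j\le m$, and put $n_1=n-\Delta$, $n_2=n$. A scalar differential operator of order at most $k$ is an operator $\sum_{s+t\le k}f_{st}\,\partial_x^s\partial_y^t$ on $C^\infty(U,\mathbb C)$ with coefficients $f_{st}\in C^\infty(U,\mathbb C)$; a $2\times2$ matrix operator has order at most $k$ if all its entries do. The distinguished complement for $\mathcal T_{n-\Delta}\oplus\mathcal T_n$ is the space of all $2\times 2$ matrix differential operators $T=(T_{rc})$ that map $\mathcal T_{n-\Delta}\oplus\mathcal T_n$ into itself and whose entries have the form $T_{rc}=\sum_{s+t\le n_c}f_{st}\,\partial_x^s\partial_y^t$. Let $J^1_m=x^2\partial_x+xy\partial_y-mx$, $J^2_m=xy\partial_x+y^2\partial_y-my$, $J^3_m=y\partial_x$, $J^4_m=\partial_x$, $J^5_m=\partial_y$, $J^6_m=x\partial_y$, $J^7_m=x\partial_x-\frac m3$, $J^8_m=y\partial_y-\frac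 m3$, and $T^i=\operatorname{diag}(J^i_{n-\Delta},J^i_n)$. Let $P_1=\operatorname{diag}(1,0)$, $P_2=\operatorname{diag}(0,1)$, $\sigma^+=\begin{pmatrix}0&1\\0&0\end{pmatrix}$, $\sigma^-=(\sigma^+)^t$, and for $\alpha,\beta\ge0$, $\alpha+\beta\le\Delta$, $$Q^-_{\alpha\beta}=x^\alpha y^\beta\,\sigma^-,\qquad Q^+_{\alpha\beta}=\prod_{l=1}^{\Delta-\alpha-\beta}(x\partial_x+y\partial_y-n+\Delta-l)\,\partial_x^\alpha\partial_y^\beta\,\sigma^+ .$$ For $\epsilon\in\{1,2,+,-\}$, a monomial of type $\epsilon$ is a product $T^K_\epsilon=X_\epsilon\,(T^1)^{k_1}\cdots(T^8)^{k_8}$ with $K\in\mathbb Z_{\ge0}^8$, where $X_1=P_1$, $X_2=P_2$ and $X_\pm$ is one of the $Q^\pm_{\alpha\beta}$; write $|K|=k_1+\dots+k_8$. A matrix operator has bidegree $(a,b)\in\mathbb Z^2$ if each of its entries maps each $x^iy^j$ ($i,j\ge0$) to a multiple of $x^{i+a}y^{j+b}$ (to $0$ if an exponent is negative). The length of $T^K_\epsilon$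 is the minimum of $|L|$ over all monomials $T^L_\epsilon$ of the same type and the same bidegree with $|L|\le|K|$, and $T^K_\epsilon$ is of maximal length if its length is $|K|$. For each $\epsilon$ choose, in any way, a set $S_\epsilon$ consisting of one monomial of type $\epsilon$ of maximal length for each bidegree that occurs. Theorem. Every operator of order at most $k$ in the distinguished complement for $\mathcal T_{n-\Delta}\oplus\mathcal T_n$ is a linear combination, with complex coefficients, of the monomials $$T^L_\epsilon\,(T^7)^i(T^8)^j,\qquad \epsilon=1,2,\pm,\quad T^L_\epsilon\in S_\epsilon,\quad i,j\ge0,\quad i+j+|L|\le k-\delta_{\epsilon+}\Delta .$$ (In particular, no monomial with $\epsilon=+$ occurs if $\Delta>k$.) -/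

import Mathlib

open scoped ContDiff

noncomputable section

namespace TriangularQES

open TopologicalSpace

/-! ### Smooth functions on an open subset of `ℂ²` and scalar differential operators -/

/-- Extension by zero of a function on `U ⊆ ℂ²`; only its values on `U` matter. -/
def ext0 (U : Opens (ℂ × ℂ)) (f : U → ℂ) : ℂ × ℂ → ℂ :=
  open Classical in fun z => if h : z ∈ U then f ⟨z, h⟩ else 0

theorem ext0_of_mem {U : Opens (ℂ × ℂ)} (f : U → ℂ) {z : ℂ × ℂ} (h : z ∈ U) :
    ext0 U f z = f ⟨z, h⟩ := by
  simp [ext0, h]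

/-- The algebra `C^∞(U, ℂ)` of complex-valued functions on `U` that are smooth in the real sense
(holomorphic functions are included). -/
def Smooth (U : Opens (ℂ × ℂ)) : Subalgebra ℂ (U → ℂ) where
  carrier := {f | ContDiffOn ℝ ∞ (ext0 U f) U}
  mul_mem' := by
    intro f g hf hg
    refine (ContDiffOn.mul hf hg).congr ?_
    intro z hz
    simp [ext0_of_mem _ (show z ∈ U from hz)]
  add_mem' := by
    intro f g hf hg
    refine (ContDiffOn.add hf hg).congr ?_
    intro z hz
    simp [ext0_of_mem _ (show z ∈ U from hz)]
  algebraMap_mem' := by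
    intro c
    refine (contDiffOn_const (c := c)).congr ?_
    intro z hz
    simp [ext0_of_mem _ (show z ∈ U from hz)]

theorem smooth_of_contDiffOn {U : Opens (ℂ × ℂ)} {F : ℂ × ℂ → ℂ}
    (hF : ContDiffOn ℝ ∞ F U) : (fun z : U => F z) ∈ Smooth U := by
  refine ContDiffOn.congr hF ?_
  intro z hz
  simp [ext0_of_mem _ (show z ∈ U from hz)]

theorem ext0_differentiableAt {U : Opens (ℂ × ℂ)} (f : Smooth U) {z : ℂ × ℂ} (hz : z ∈ U) :
    DifferentiableAt ℝ (ext0 U f) z :=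
  (ContDiffOn.contDiffAt f.2 (U.isOpen.mem_nhds hz)).differentiableAt (by simp)

theorem ext0_add {U : Opens (ℂ × ℂ)} (f g : U → ℂ) :
    ext0 U (f + g) = ext0 U f + ext0 U g := by
  funext z
  by_cases h : z ∈ U <;> simp [ext0, h]

theorem ext0_smul {U : Opens (ℂ × ℂ)} (c : ℂ) (f : U → ℂ) :
    ext0 U (c • f) = c • ext0 U f := by
  funext z
  by_cases h : z ∈ U <;> simp [ext0, h]

/-- The complex coordinate vector field in the direction `v`, as an operator on `C^∞(U, ℂ)`:
`½ (D_v - i D_{iv})`, where `D` is the real derivative. On holomorphic functions it is the complex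
derivative in the direction `v`. -/
def coordDeriv (U : Opens (ℂ × ℂ)) (v : ℂ × ℂ) : Module.End ℂ (Smooth U) where
  toFun f := ⟨fun z => (1 / 2 : ℂ) *
      (fderiv ℝ (ext0 U f) z v - Complex.I * fderiv ℝ (ext0 U f) z (Complex.I • v)), by
    have h : ContDiffOn ℝ ∞ (fderiv ℝ (ext0 U f)) U :=
      ContDiffOn.fderiv_of_isOpen f.2 U.isOpen (by simp)
    exact smooth_of_contDiffOn
      (F := fun z => (1 / 2 : ℂ) *
        (fderiv ℝ (ext0 U f) z v - Complex.I * fderiv ℝ (ext0 U f) z (Complex.I • v)))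
      (contDiffOn_const.mul ((h.clm_apply contDiffOn_const).sub
        (contDiffOn_const.mul (h.clm_apply contDiffOn_const))))⟩
  map_add' f g := by
    ext z
    have e : fderiv ℝ (ext0 U ((f : U → ℂ) + (g : U → ℂ))) z
        = fderiv ℝ (ext0 U f) z + fderiv ℝ (ext0 U g) z := by
      rw [ext0_add]
      exact fderiv_add (ext0_differentiableAt f z.2) (ext0_differentiableAt g z.2)
    simp only [Subalgebra.coe_add, Pi.add_apply, e, add_apply]
    ring
  map_smul' c f := by
    ext z
    have e : fderiv ℝ (ext0 U (c • (f : U → ℂ))) z = c • fderiv ℝ (ext0 U f) z := by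
      rw [ext0_smul]
      exact fderiv_const_smul (ext0_differentiableAt f z.2) c
    simp only [Subalgebra.coe_smul, Pi.smul_apply, e, smul_apply,
      RingHom.id_apply, smul_eq_mul]
    ring

/-- `∂_x`. -/
def dx (U : Opens (ℂ × ℂ)) : Module.End ℂ (Smooth U) := coordDeriv U (1, 0)

/-- `∂_y`. -/
def dy (U : Opens (ℂ × ℂ)) : Module.End ℂ (Smooth U) := coordDeriv U (0, 1)

/-- The coordinate function `x`. -/
def cx (U : Opens (ℂ × ℂ)) : Smooth U :=
  ⟨fun z => z.1.1, smooth_of_contDiffOn (F := fun z => z.1) contDiff_fst.contDiffOn⟩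

/-- The coordinate function `y`. -/
def cy (U : Opens (ℂ × ℂ)) : Smooth U :=
  ⟨fun z => z.1.2, smooth_of_contDiffOn (F := fun z => z.2) contDiff_snd.contDiffOn⟩

/-- The multiplication operator by a smooth function. -/
def mulOp (U : Opens (ℂ × ℂ)) (f : Smooth U) : Module.End ℂ (Smooth U) := LinearMap.mulLeft ℂ f

/-- `T` is a differential operator of order at most `k`:
`T = ∑_{s + t ≤ k} f_{st} ∂_x^s ∂_y^t` with smooth coefficients `f_{st}`. -/
def HasOrderLE (U : Opens (ℂ × ℂ)) (k : ℕ) (T : Module.End ℂ (Smooth U)) : Prop :=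
  ∃ f : ℕ → ℕ → Smooth U,
    T = ∑ s ∈ Finset.range (k + 1), ∑ t ∈ Finset.range (k + 1 - s),
      mulOp U (f s t) * dx U ^ s * dy U ^ t

/-- The triangular module `𝒯_n`, spanned by the monomials `x^i y^j` with `i + j ≤ n`. -/
def triModule (U : Opens (ℂ × ℂ)) (n : ℕ) : Submodule ℂ (Smooth U) :=
  Submodule.span ℂ {p | ∃ i j : ℕ, i + j ≤ n ∧ p = cx U ^ i * cy U ^ j}

/-- The eight generators `J¹_n, …, J⁸_n` (indexed from `0`) of the realization of `𝔰𝔩₃`. -/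
def genJ (U : Opens (ℂ × ℂ)) (n : ℕ) : Fin 8 → Module.End ℂ (Smooth U) :=
  let X := mulOp U (cx U)
  let Y := mulOp U (cy U)
  ![X ^ 2 * dx U + X * Y * dy U - (n : ℂ) • X,
    X * Y * dx U + Y ^ 2 * dy U - (n : ℂ) • Y,
    Y * dx U,
    dx U,
    dy U,
    X * dy U,
    X * dx U - ((n : ℂ) / 3) • 1,
    Y * dy U - ((n : ℂ) / 3) • 1]

/-- `q̄_{αβ}(n, Δ) = ∏_{k=1}^{Δ-α-β} (x∂_x + y∂_y - n + Δ - k) ∂_x^α ∂_y^β`. -/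
def qBar (U : Opens (ℂ × ℂ)) (n Δ α β : ℕ) : Module.End ℂ (Smooth U) :=
  ((List.range (Δ - α - β)).map fun k =>
    mulOp U (cx U) * dx U + mulOp U (cy U) * dy U
      + (-(n : ℂ) + (Δ : ℂ) - ((k + 1 : ℕ) : ℂ)) • (1 : Module.End ℂ (Smooth U))).prod
    * dx U ^ α * dy U ^ β

/-! ### `2 × 2` matrix operators -/

/-- `2 × 2` matrices of operators on `C^∞(U, ℂ)`; the product is composition. -/
abbrev MatOp (U : Opens (ℂ × ℂ)) := Matrix (Fin 2) (Fin 2) (Module.End ℂ (Smooth U))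

/-- The action of a matrix operator on `C^∞(U, ℂ ⊕ ℂ)`. -/
def act {U : Opens (ℂ × ℂ)} (T : MatOp U) (v : Fin 2 → Smooth U) : Fin 2 → Smooth U :=
  fun r => ∑ c, T r c (v c)

/-- The two degrees `n₁ = n - Δ` and `n₂ = n` (used with `Δ ≤ n`). -/
def compDeg (n Δ : ℕ) : Fin 2 → ℕ := ![n - Δ, n]

/-- `T` leaves `𝒯_{n-Δ} ⊕ 𝒯_n` invariant. -/
def PreservesModule (U : Opens (ℂ × ℂ)) (n Δ : ℕ) (T : MatOp U) : Prop :=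
  ∀ v : Fin 2 → Smooth U, (∀ c, v c ∈ triModule U (compDeg n Δ c)) →
    ∀ r, act T v r ∈ triModule U (compDeg n Δ r)

/-- `T` lies in the distinguished complement, in the algebra of the matrix differential operators
preserving `𝒯_{n₁} ⊕ 𝒯_{n₂}`, to those annihilating it: `T` preserves the module and
`T_{rc} = ∑_{s + t ≤ n_c} f_{st} ∂_x^s ∂_y^t`. -/
def InDistinguishedComplement (U : Opens (ℂ × ℂ)) (n Δ : ℕ) (T : MatOp U) : Prop :=
  PreservesModule U n Δ T ∧ ∀ r c, HasOrderLE U (compDeg n Δ c) (T r c)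

/-- A matrix differential operator of order at most `k`. -/
def MatHasOrderLE (U : Opens (ℂ × ℂ)) (k : ℕ) (T : MatOp U) : Prop :=
  ∀ r c, HasOrderLE U k (T r c)

/-- `T^i = diag(J^i_{n-Δ}, J^i_n)` (indexed from `0`). -/
def genT (U : Opens (ℂ × ℂ)) (n Δ : ℕ) (i : Fin 8) : MatOp U :=
  Matrix.diagonal ![genJ U (n - Δ) i, genJ U n i]

/-- The four values `1, 2, +, -` of the label `ε`. -/
inductive Kind
  | one
  | two
  | plus
  | minus

/-- The data `(α, β, K)` of a monomial `X_ε T^K`; `(α, β)` is `(0, 0)` for `ε = 1, 2`. -/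
structure MonIdx where
  α : ℕ
  β : ℕ
  K : Fin 8 → ℕ

/-- The indices that are allowed for the type `ε`. -/
def MonIdx.Admissible (Δ : ℕ) : Kind → MonIdx → Prop
  | .one, m => m.α = 0 ∧ m.β = 0
  | .two, m => m.α = 0 ∧ m.β = 0
  | .plus, m => m.α + m.β ≤ Δ
  | .minus, m => m.α + m.β ≤ Δ

/-- The degree `|K| = k₁ + ⋯ + k₈`. -/
def MonIdx.degree (m : MonIdx) : ℕ := ∑ i, m.K i

/-- The factor `X_ε`: `X_1 = P_1`, `X_2 = P_2`, `X_+ = Q⁺_{αβ} = q̄_{αβ}(n, Δ) σ⁺`,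
`X_- = Q⁻_{αβ} = x^α y^β σ⁻`. -/
def prefactor (U : Opens (ℂ × ℂ)) (n Δ : ℕ) (ε : Kind) (α β : ℕ) : MatOp U :=
  match ε with
  | .one => !![1, 0; 0, 0]
  | .two => !![0, 0; 0, 1]
  | .plus => !![0, qBar U n Δ α β; 0, 0]
  | .minus => !![0, 0; mulOp U (cx U ^ α * cy U ^ β), 0]

/-- The monomial `T^K_ε = X_ε (T¹)^{k₁} ⋯ (T⁸)^{k₈}`. -/
def monOp (U : Opens (ℂ × ℂ)) (n Δ : ℕ) (ε : Kind) (m : MonIdx) : MatOp U :=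
  prefactor U n Δ ε m.α m.β * (List.ofFn fun i : Fin 8 => genT U n Δ i ^ m.K i).prod

/-- The line spanned by `x^i y^j`, for integer exponents; it is `0` if an exponent is negative. -/
def monomialLine (U : Opens (ℂ × ℂ)) (i j : ℤ) : Submodule ℂ (Smooth U) :=
  Submodule.span ℂ {p | ∃ a b : ℕ, (a : ℤ) = i ∧ (b : ℤ) = j ∧ p = cx U ^ a * cy U ^ b}

/-- `T` has bidegree `d`: every entry of `T` maps `x^i y^j` into the line spanned by
`x^{i + d₁} y^{j + d₂}`. -/
def HasBidegree {U : Opens (ℂ × ℂ)} (T : MatOp U) (d : ℤ × ℤ) : Prop :=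
  ∀ (r c : Fin 2) (i j : ℕ), T r c (cx U ^ i * cy U ^ j) ∈ monomialLine U (i + d.1) (j + d.2)

/-- Two monomials of type `ε` have the same bidegree. -/
def SameBidegree (U : Opens (ℂ × ℂ)) (n Δ : ℕ) (ε : Kind) (m m' : MonIdx) : Prop :=
  ∃ d : ℤ × ℤ, HasBidegree (monOp U n Δ ε m) d ∧ HasBidegree (monOp U n Δ ε m') d

/-- The length of `T^K_ε`: the minimum of `|L|` over the monomials `T^L_ε` of the same type and the
same bidegree with `|L| ≤ |K|`. -/
def monLength (U : Opens (ℂ × ℂ)) (n Δ : ℕ) (ε : Kind) (m : MonIdx) : ℕ :=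
  sInf {l | ∃ m' : MonIdx, m'.Admissible Δ ε ∧ SameBidegree U n Δ ε m' m ∧
    m'.degree ≤ m.degree ∧ l = m'.degree}

/-- `T^K_ε` is a monomial of type `ε` of maximal length: its length is `|K|`. -/
def IsMaximalLength (U : Opens (ℂ × ℂ)) (n Δ : ℕ) (ε : Kind) (m : MonIdx) : Prop :=
  m.Admissible Δ ε ∧ monLength U n Δ ε m = m.degree

/-- `S` consists of monomials of maximal length of type `ε` with different bidegrees, one for each
bidegree that occurs. -/
def IsRepresentativeSystem (U : Opens (ℂ × ℂ)) (n Δ : ℕ) (ε : Kind) (S : Set MonIdx) : Prop :=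
  (∀ m ∈ S, IsMaximalLength U n Δ ε m) ∧
    ∀ m, IsMaximalLength U n Δ ε m → ∃! m', m' ∈ S ∧ SameBidegree U n Δ ε m' m

/-- `Δ` for `ε = +`, and `0` otherwise. -/
def shift (Δ : ℕ) : Kind → ℕ
  | .plus => Δ
  | _ => 0

/-- The monomials `T^L_ε (T⁷)^i (T⁸)^j`, where `ε = 1, 2, ±`, `T^L_ε` runs through the chosen
monomials of maximal length and `i + j + |L| ≤ k - δ_{ε+} Δ` (an inequality of integers). -/
def spanningMonomials (U : Opens (ℂ × ℂ)) (n Δ k : ℕ) (S : Kind → Set MonIdx) : Set (MatOp U) :=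
  {M | ∃ (ε : Kind) (m : MonIdx) (i j : ℕ), m ∈ S ε ∧ i + j + m.degree + shift Δ ε ≤ k ∧
    M = monOp U n Δ ε m * genT U n Δ 6 ^ i * genT U n Δ 7 ^ j}

end TriangularQES

end

/-! Every entry of `T` is a sum of operators of bounded order that are homogeneous for the bidegree
and still preserve the triangular modules. A homogeneous operator of bidegree `(a, b)` maps
`x^i y^j` to `p(i, j) x^{i+a} y^{j+b}` for a polynomial `p`, its symbol, whose total degree is at
most the order. The symbol vanishes on the lines `x = q` with `0 ≤ q < -a` and `y = q` with
`0 ≤ q < -b`, and, by invariance, at the lattice points of the antidiagonals `x + y = m - q` which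
the bidegree moves out of the target module. As the order is at most `m`, these are more zeros on
each antidiagonal than the degree that is left once the previous lines are split off, so the
equations of all the lines divide the symbol.

In each bidegree there is a monomial whose order is at most the number of these lines; hence so is
that of a chosen representative, whose symbol is then a scalar multiple of the product of the
equations and divides every other symbol of this bidegree. Expanding the quotient in powers of
`x - n_c/3` and `y - n_c/3`, the symbols of `T⁷` and `T⁸`, gives the result, because an operator is
determined by its symbol. -/

noncomputable section

namespace TriangularQES

/-! ### Polynomials vanishing at lattice points of lines -/

section Division

variable {σ K : Type*} [CommRing K]

open MvPolynomial

theorem dvd_sub_algHom_apply {l : MvPolynomial σ K} {φ : MvPolynomial σ K →ₐ[K] MvPolynomial σ K}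
    (h : ∀ i, l ∣ X i - φ (X i)) (p : MvPolynomial σ K) : l ∣ p - φ p := by
  let π := Ideal.Quotient.mkₐ K (Ideal.span {l})
  have π_eq : π = π.comp φ := algHom_ext fun i =>
    Ideal.Quotient.eq.2 (Ideal.mem_span_singleton.2 (h i))
  exact Ideal.mem_span_singleton.1 (Ideal.Quotient.eq.1 (DFunLike.congr_fun π_eq p))

theorem dvd_of_totalDegree_lt_card [IsDomain K] {l u p : MvPolynomial σ K} {s : σ → Polynomial K}
    (hs : ∀ i, (s i).natDegree ≤ 1) (hl : ∀ i, l ∣ X i - Polynomial.aeval u (s i)) {A : Finset K}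
    (hA : p.totalDegree < A.card) (hp : ∀ t ∈ A, eval (fun i => (s i).eval t) p = 0) : l ∣ p := by
  -- On the line parametrised by `s`, `p` has more roots than its degree.
  have restriction_eq_zero : aeval s p = 0 := by
    refine Polynomial.eq_zero_of_natDegree_lt_card_of_eval_eq_zero' _ A (fun t ht => ?_)
      ((aeval_natDegree_le _ le_rfl _ hs).trans_lt (by rwa [mul_one]))
    rw [← hp t ht, ← Polynomial.coe_aeval_eq_eval, comp_aeval_apply]
    rfl
  have h := dvd_sub_algHom_apply (φ := (Polynomial.aeval u).comp (aeval s))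
    (fun i => by simpa using hl i) p
  rwa [AlgHom.comp_apply, restriction_eq_zero, map_zero, sub_zero] at h

theorem mul_dvd_of_totalDegree_lt_add_card [IsDomain K] {l u p D : MvPolynomial σ K}
    {s : σ → Polynomial K} (hs : ∀ i, (s i).natDegree ≤ 1)
    (hl : ∀ i, l ∣ X i - Polynomial.aeval u (s i)) (hD : D ∣ p) {A : Finset K}
    (hA : p.totalDegree < D.totalDegree + A.card) (hp : ∀ t ∈ A, eval (fun i => (s i).eval t) p = 0)
    (hD' : ∀ t ∈ A, eval (fun i => (s i).eval t) D ≠ 0) : D * l ∣ p := by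
  obtain ⟨r, rfl⟩ := hD
  rcases eq_or_ne (D * r) 0 with h0 | h0
  · simp [h0]
  rw [totalDegree_mul_of_isDomain (left_ne_zero_of_mul h0) (right_ne_zero_of_mul h0)] at hA
  have hr : r.totalDegree < A.card := by omega
  refine mul_dvd_mul_left D (dvd_of_totalDegree_lt_card hs hl hr fun t ht => ?_)
  have := hp t ht
  rw [map_mul] at this
  exact (mul_eq_zero.1 this).resolve_left (hD' t ht)

theorem dvd_of_dvd_of_totalDegree_le {K : Type*} [Field K] {D p : MvPolynomial σ K} (h : D ∣ p)
    (hp : p ≠ 0) (hdeg : p.totalDegree ≤ D.totalDegree) : p ∣ D := by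
  obtain ⟨r, rfl⟩ := h
  have hr : r ≠ 0 := right_ne_zero_of_mul hp
  rw [totalDegree_mul_of_isDomain (left_ne_zero_of_mul hp) hr] at hdeg
  have r_eq := totalDegree_eq_zero_iff_eq_C.1 (show r.totalDegree = 0 by omega)
  have unit : IsUnit r := by
    rw [r_eq] at hr ⊢
    exact (isUnit_iff_ne_zero.2 (C_ne_zero.1 hr)).map C
  exact unit.dvd_mul_right.1 dvd_rfl

theorem totalDegree_aeval_le {K : Type*} [CommSemiring K] {f : σ → MvPolynomial σ K}
    (hf : ∀ i, (f i).totalDegree ≤ 1) (p : MvPolynomial σ K) :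
    (aeval f p).totalDegree ≤ p.totalDegree := by
  rw [aeval_def, eval₂_eq]
  refine totalDegree_finsetSum_le fun d hd => (totalDegree_mul _ _).trans ?_
  rw [algebraMap_eq, totalDegree_C, zero_add]
  refine (totalDegree_finsetProd _ _).trans ((Finset.sum_le_sum fun i _ => ?_).trans
    (le_totalDegree hd))
  exact (totalDegree_pow _ _).trans ((Nat.mul_le_mul_left _ (hf i)).trans_eq (mul_one _))

theorem mem_span_prod_X_sub_C (c : σ → K) {e : ℕ} {p : MvPolynomial σ K}
    (hp : p.totalDegree ≤ e) : p ∈ Submodule.span K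
      {q | ∃ d : σ →₀ ℕ, d.degree ≤ e ∧ q = d.prod fun i n => (X i - C (c i)) ^ n} := by
  have eq_aeval : p = aeval (fun i => X i - C (c i)) (aeval (fun i => X i + C (c i)) p) := by
    rw [← AlgHom.comp_apply]
    refine DFunLike.congr_fun (f := AlgHom.id K _) (algHom_ext fun i => ?_) p
    simp [algebraMap_eq]
  rw [eq_aeval, aeval_def, eval₂_eq]
  refine sum_mem fun d hd => ?_
  rw [algebraMap_eq, ← smul_eq_C_mul]
  have degree_le : d.degree ≤ e := (le_totalDegree hd).trans
    ((totalDegree_aeval_le (fun i => (totalDegree_add _ _).trans (max_le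
      ((totalDegree_monomial_le _ _).trans (by simp)) (by simp))) p).trans hp)
  exact Submodule.smul_mem _ _ (Submodule.subset_span ⟨d, degree_le, rfl⟩)

end Division

section Factors

open MvPolynomial

theorem prod_ne_zero_of_totalDegree_eq_one {ι σ K : Type*} [CommRing K] [IsDomain K] {s : Finset ι}
    {f : ι → MvPolynomial σ K} (hf : ∀ i ∈ s, (f i).totalDegree = 1) : ∏ i ∈ s, f i ≠ 0 :=
  Finset.prod_ne_zero_iff.2 fun i hi h => by simpa [h] using hf i hi

theorem totalDegree_prod_eq_card {ι σ K : Type*} [CommRing K] [IsDomain K] {s : Finset ι}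
    {f : ι → MvPolynomial σ K} (hf : ∀ i ∈ s, (f i).totalDegree = 1) :
    (∏ i ∈ s, f i).totalDegree = s.card := by
  classical
  induction s using Finset.induction_on with
  | empty => simp
  | insert i s his ih =>
    have hprod := prod_ne_zero_of_totalDegree_eq_one hf
    rw [Finset.forall_mem_insert] at hf
    rw [Finset.prod_insert his] at hprod ⊢
    rw [totalDegree_mul_of_isDomain (left_ne_zero_of_mul hprod) (right_ne_zero_of_mul hprod), hf.1,
      ih hf.2, Finset.card_insert_of_notMem his, add_comm]

theorem totalDegree_eq_one_of_eval_ne {σ K : Type*} [CommSemiring K] {p : MvPolynomial σ K}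
    (hp : p.totalDegree ≤ 1) {x y : σ → K} (hxy : eval x p ≠ eval y p) : p.totalDegree = 1 := by
  by_contra h
  rw [totalDegree_eq_zero_iff_eq_C.1 (show p.totalDegree = 0 by omega), eval_C, eval_C] at hxy
  exact hxy rfl

variable (K : Type*) [CommRing K]

/-- The product of falling factorials `x(x-1)⋯(x-a+1) · y(y-1)⋯(y-b+1)`, whose value at `(i, j)` is
the eigenvalue of `x^a y^b ∂_x^a ∂_y^b` on `x^i y^j`. -/
def fallingFactor (a b : ℕ) : MvPolynomial (Fin 2) K :=
  (∏ q ∈ Finset.range a, (X 0 - C (q : K))) * ∏ q ∈ Finset.range b, (X 1 - C (q : K))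

/-- The product of the `c` antidiagonals `x + y = m, m - 1, …, m - c + 1`. -/
def diagonalFactor (m c : ℕ) : MvPolynomial (Fin 2) K :=
  ∏ q ∈ Finset.range c, (X 0 + X 1 - C ((m : K) - q))

variable {K}

theorem eval_fallingFactor (a b i j : ℕ) : eval ![(i : K), (j : K)] (fallingFactor K a b)
    = (i.descFactorial a * j.descFactorial b : ℕ) := by
  rw [Nat.cast_mul, ← descPochhammer_eval_eq_descFactorial, ← descPochhammer_eval_eq_descFactorial,
    descPochhammer_eval_eq_prod_range, descPochhammer_eval_eq_prod_range]
  simp [fallingFactor, map_prod]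

theorem eval_diagonalFactor_ne_zero [IsDomain K] [CharZero K] {m c i j : ℕ} (h : i + j + c ≤ m) :
    eval ![(i : K), (j : K)] (diagonalFactor K m c) ≠ 0 := by
  rw [diagonalFactor, map_prod]
  refine Finset.prod_ne_zero_iff.2 fun q hq h0 => ?_
  rw [Finset.mem_range] at hq
  have cast_eq : ((i + j + q : ℕ) : K) = m := by
    simp only [map_sub, map_add, eval_X, eval_C, Matrix.cons_val_zero, Matrix.cons_val_one] at h0
    push_cast
    linear_combination h0
  have := Nat.cast_injective cast_eq
  omega

theorem fallingFactor_dvd_fallingFactor {a a' b b' : ℕ} (ha : a ≤ a') (hb : b ≤ b') :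
    fallingFactor K a b ∣ fallingFactor K a' b' :=
  mul_dvd_mul (Finset.prod_dvd_prod_of_subset _ _ _ (Finset.range_mono ha))
    (Finset.prod_dvd_prod_of_subset _ _ _ (Finset.range_mono hb))

theorem totalDegree_X_sub_C [Nontrivial K] (i : Fin 2) (c : K) :
    (X i - C c : MvPolynomial (Fin 2) K).totalDegree = 1 :=
  totalDegree_eq_one_of_eval_ne (x := fun _ => c) (y := fun _ => c + 1)
    ((totalDegree_sub _ _).trans (by simp)) (by simp)

theorem totalDegree_X_add_X_sub_C [Nontrivial K] (c : K) :
    (X 0 + X 1 - C c : MvPolynomial (Fin 2) K).totalDegree = 1 := by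
  refine totalDegree_eq_one_of_eval_ne (x := ![c, 0]) (y := ![c + 1, 0])
    ((totalDegree_sub _ _).trans ?_) (by simp)
  rw [totalDegree_C, max_eq_left (Nat.zero_le _)]
  exact (totalDegree_add _ _).trans (by simp)

theorem fallingFactor_ne_zero [IsDomain K] (a b : ℕ) : fallingFactor K a b ≠ 0 :=
  mul_ne_zero (prod_ne_zero_of_totalDegree_eq_one fun _ _ => totalDegree_X_sub_C _ _)
    (prod_ne_zero_of_totalDegree_eq_one fun _ _ => totalDegree_X_sub_C _ _)

theorem totalDegree_fallingFactor [IsDomain K] (a b : ℕ) :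
    (fallingFactor K a b).totalDegree = a + b := by
  have h := fallingFactor_ne_zero (K := K) a b
  rw [fallingFactor] at h ⊢
  rw [totalDegree_mul_of_isDomain (left_ne_zero_of_mul h) (right_ne_zero_of_mul h),
    totalDegree_prod_eq_card fun _ _ => totalDegree_X_sub_C _ _,
    totalDegree_prod_eq_card fun _ _ => totalDegree_X_sub_C _ _, Finset.card_range,
    Finset.card_range]

theorem totalDegree_fallingFactor_mul_diagonalFactor [IsDomain K] (a b m c : ℕ) :
    (fallingFactor K a b * diagonalFactor K m c).totalDegree = a + b + c := by
  have hlines : ∀ q ∈ Finset.range c,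
      (X 0 + X 1 - C ((m : K) - q) : MvPolynomial (Fin 2) K).totalDegree = 1 :=
    fun q _ => totalDegree_X_add_X_sub_C _
  rw [diagonalFactor, totalDegree_mul_of_isDomain (fallingFactor_ne_zero a b)
    (prod_ne_zero_of_totalDegree_eq_one hlines), totalDegree_fallingFactor,
    totalDegree_prod_eq_card hlines, Finset.card_range]

theorem mul_X_add_X_sub_C_dvd [IsDomain K] {p D : MvPolynomial (Fin 2) K} {c : K} (hD : D ∣ p)
    {A : Finset K} (hA : p.totalDegree < D.totalDegree + A.card)
    (hp : ∀ t ∈ A, eval ![t, c - t] p = 0) (hD' : ∀ t ∈ A, eval ![t, c - t] D ≠ 0) :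
    D * (X 0 + X 1 - C c) ∣ p := by
  have point_eq (t : K) :
      (fun i => (![Polynomial.X, Polynomial.C c - Polynomial.X] i).eval t) = ![t, c - t] := by
    ext i
    fin_cases i <;> simp
  refine mul_dvd_of_totalDegree_lt_add_card (u := X 0)
    (s := ![Polynomial.X, Polynomial.C c - Polynomial.X]) ?_ ?_ hD hA
    (fun t ht => by rw [point_eq]; exact hp t ht) (fun t ht => by rw [point_eq]; exact hD' t ht)
  · rw [Fin.forall_fin_two]
    exact ⟨Polynomial.natDegree_X_le, (Polynomial.natDegree_sub_le _ _).trans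
      (max_le ((Polynomial.natDegree_C _).trans_le zero_le_one) Polynomial.natDegree_X_le)⟩
  · rw [Fin.forall_fin_two]
    refine ⟨by simp, dvd_of_eq ?_⟩
    simp only [Matrix.cons_val_one, Matrix.cons_val_fin_one, map_sub, Polynomial.aeval_C,
      Polynomial.aeval_X, algebraMap_eq]
    ring

theorem fallingFactor_mul_diagonalFactor_dvd [IsDomain K] [CharZero K] {m a b c : ℕ}
    {p : MvPolynomial (Fin 2) K} (hdeg : p.totalDegree ≤ m) (hdvd : fallingFactor K a b ∣ p)
    (hp : ∀ i j : ℕ, i + j ≤ m → m < i + j + c → eval ![(i : K), (j : K)] p = 0) :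
    fallingFactor K a b * diagonalFactor K m c ∣ p := by
  induction c with
  | zero => simpa [diagonalFactor] using hdvd
  | succ c ih =>
    rw [diagonalFactor, Finset.prod_range_succ, ← diagonalFactor, ← mul_assoc]
    have cast_sub_sub {t : ℕ} (ht : t ∈ Finset.Ico a (m + 1 - c - b)) :
        (m : K) - c - t = (m - c - t : ℕ) := by
      rw [Finset.mem_Ico] at ht
      rw [Nat.cast_sub (by omega), Nat.cast_sub (by omega)]
    -- The zeros of `p` used here are the lattice points `(t, m - c - t)` with `a ≤ t ≤ m - c - b`.
    refine mul_X_add_X_sub_C_dvd (A := (Finset.Ico a (m + 1 - c - b)).map ⟨_, Nat.cast_injective⟩)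
      (ih fun i j h h' => hp i j h (by omega)) ?_ ?_ ?_
    · rw [totalDegree_fallingFactor_mul_diagonalFactor, Finset.card_map, Nat.card_Ico]
      omega
    · simp only [Finset.forall_mem_map, Function.Embedding.coeFn_mk]
      intro t ht
      rw [cast_sub_sub ht]
      rw [Finset.mem_Ico] at ht
      exact hp _ _ (by omega) (by omega)
    · simp only [Finset.forall_mem_map, Function.Embedding.coeFn_mk]
      intro t ht
      rw [cast_sub_sub ht, map_mul, eval_fallingFactor]
      rw [Finset.mem_Ico] at ht
      refine mul_ne_zero (Nat.cast_ne_zero.2 ?_) (eval_diagonalFactor_ne_zero (by omega))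
      simp only [ne_eq, mul_eq_zero, Nat.descFactorial_eq_zero_iff_lt, not_or, not_lt]
      omega

end Factors

open TopologicalSpace

variable {U : Opens (ℂ × ℂ)}

/-! ### Calculus on `C^∞(U, ℂ)` -/

theorem coordDeriv_apply (v : ℂ × ℂ) (f : Smooth U) (z : U) :
    (coordDeriv U v f : U → ℂ) z = (1 / 2 : ℂ) *
      (fderiv ℝ (ext0 U f) z v - Complex.I * fderiv ℝ (ext0 U f) z (Complex.I • v)) := rfl

theorem ext0_eventuallyEq {F : ℂ × ℂ → ℂ} {f : U → ℂ} (h : ∀ z : U, f z = F z) (z : U) :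
    ext0 U f =ᶠ[nhds (z : ℂ × ℂ)] F := by
  filter_upwards [U.isOpen.mem_nhds z.2] with w hw
  rw [ext0_of_mem f hw, h]

theorem ext0_mul (f g : U → ℂ) : ext0 U (f * g) = ext0 U f * ext0 U g := by
  funext z
  by_cases h : z ∈ U <;> simp [ext0, h]

theorem coordDeriv_mul (v : ℂ × ℂ) (f g : Smooth U) :
    coordDeriv U v (f * g) = f * coordDeriv U v g + g * coordDeriv U v f := by
  ext z
  have product_rule : fderiv ℝ (ext0 U ((f : U → ℂ) * (g : U → ℂ))) z
      = ext0 U f z • fderiv ℝ (ext0 U g) z + ext0 U g z • fderiv ℝ (ext0 U f) z := by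
    rw [ext0_mul]
    exact fderiv_mul (ext0_differentiableAt f z.2) (ext0_differentiableAt g z.2)
  simp only [coordDeriv_apply, Subalgebra.coe_mul, Subalgebra.coe_add, Pi.add_apply,
    Pi.mul_apply, product_rule, ext0_of_mem _ z.2, add_apply, smul_apply, smul_eq_mul]
  ring

theorem coordDeriv_eq_of_clm (v : ℂ × ℂ) (f : Smooth U) (φ : (ℂ × ℂ) →L[ℂ] ℂ)
    (h : ∀ z : U, (f : U → ℂ) z = φ z) (z : U) : (coordDeriv U v f : U → ℂ) z = φ v := by
  have fderiv_eq : fderiv ℝ (ext0 U f) z = φ.restrictScalars ℝ := by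
    rw [(ext0_eventuallyEq (F := φ.restrictScalars ℝ) h z).fderiv_eq]
    exact ContinuousLinearMap.fderiv _
  rw [coordDeriv_apply, fderiv_eq]
  simp only [ContinuousLinearMap.coe_restrictScalars', map_smul, smul_eq_mul]
  linear_combination (-φ v / 2) * Complex.I_mul_I

theorem dx_cx : dx U (cx U) = 1 :=
  Subtype.ext <| funext <|
    coordDeriv_eq_of_clm (1, 0) (cx U) (ContinuousLinearMap.fst ℂ ℂ ℂ) fun _ => rfl

theorem dx_cy : dx U (cy U) = 0 :=
  Subtype.ext <| funext <|
    coordDeriv_eq_of_clm (1, 0) (cy U) (ContinuousLinearMap.snd ℂ ℂ ℂ) fun _ => rfl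

theorem dy_cx : dy U (cx U) = 0 :=
  Subtype.ext <| funext <|
    coordDeriv_eq_of_clm (0, 1) (cx U) (ContinuousLinearMap.fst ℂ ℂ ℂ) fun _ => rfl

theorem dy_cy : dy U (cy U) = 1 :=
  Subtype.ext <| funext <|
    coordDeriv_eq_of_clm (0, 1) (cy U) (ContinuousLinearMap.snd ℂ ℂ ℂ) fun _ => rfl

theorem fderiv_ext0_coordDeriv (v w : ℂ × ℂ) (f : Smooth U) (z : U) :
    fderiv ℝ (ext0 U (coordDeriv U v f)) z w = (1 / 2 : ℂ) *
      (fderiv ℝ (fderiv ℝ (ext0 U f)) z w v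
        - Complex.I * fderiv ℝ (fderiv ℝ (ext0 U f)) z w (Complex.I • v)) := by
  have fderiv_differentiableAt : DifferentiableAt ℝ (fderiv ℝ (ext0 U f)) z := by
    have h : ContDiffOn ℝ ∞ (fderiv ℝ (ext0 U f)) U :=
      ContDiffOn.fderiv_of_isOpen f.2 U.isOpen (by simp)
    exact (h.contDiffAt (U.isOpen.mem_nhds z.2)).differentiableAt (by simp)
  have hasFDerivAt_apply (u : ℂ × ℂ) : HasFDerivAt (fun y => fderiv ℝ (ext0 U f) y u)
      ((fderiv ℝ (fderiv ℝ (ext0 U f)) z).flip u) z :=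
    (fderiv_differentiableAt.hasFDerivAt.clm_apply
      (hasFDerivAt_const u (z : ℂ × ℂ))).congr_fderiv (by simp)
  rw [(ext0_eventuallyEq (F := fun y => (1 / 2 : ℂ) * (fderiv ℝ (ext0 U f) y v
    - Complex.I * fderiv ℝ (ext0 U f) y (Complex.I • v))) (coordDeriv_apply v f) z).fderiv_eq]
  refine (congrArg (fun L => L w) (((hasFDerivAt_apply v).sub
    ((hasFDerivAt_apply (Complex.I • v)).const_mul Complex.I)).const_mul
      (1 / 2 : ℂ)).fderiv).trans ?_
  simp

theorem coordDeriv_comm (v w : ℂ × ℂ) : Commute (coordDeriv U v) (coordDeriv U w) := by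
  refine LinearMap.ext fun f => Subtype.ext <| funext fun z => ?_
  have symm : IsSymmSndFDerivAt ℝ (ext0 U f) z :=
    (f.2.contDiffAt (U.isOpen.mem_nhds z.2)).isSymmSndFDerivAt (by
      rw [minSmoothness_of_isRCLikeNormedField]; exact WithTop.coe_le_coe.2 (le_top : (2 : ℕ∞) ≤ ⊤))
  rw [Module.End.mul_apply, Module.End.mul_apply, coordDeriv_apply, coordDeriv_apply]
  simp only [fderiv_ext0_coordDeriv]
  rw [symm.eq v w, symm.eq v (Complex.I • w), symm.eq (Complex.I • v) w,
    symm.eq (Complex.I • v) (Complex.I • w)]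
  ring

/-- The operator `coordDeriv U v`, bundled as a derivation of the algebra `C^∞(U, ℂ)`. -/
def coordDerivation (U : Opens (ℂ × ℂ)) (v : ℂ × ℂ) : Derivation ℂ (Smooth U) (Smooth U) :=
  Derivation.mk' (coordDeriv U v) (coordDeriv_mul v)

theorem coordDeriv_pow_mul_pow (v : ℂ × ℂ) (f g : Smooth U) (i j : ℕ) :
    coordDeriv U v (f ^ i * g ^ j)
      = (i : ℂ) • (f ^ (i - 1) * g ^ j * coordDeriv U v f)
        + (j : ℂ) • (f ^ i * g ^ (j - 1) * coordDeriv U v g) := by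
  change coordDerivation U v (f ^ i * g ^ j)
    = _ • (_ * coordDerivation U v f) + _ • (_ * coordDerivation U v g)
  simp only [Derivation.leibniz, Derivation.leibniz_pow, smul_eq_mul, nsmul_eq_mul,
    Nat.cast_smul_eq_nsmul]
  ring

/-! ### Monomials -/

/-- The monomial `x^i y^j` as a smooth function. -/
def mono (U : Opens (ℂ × ℂ)) (i j : ℕ) : Smooth U := cx U ^ i * cy U ^ j

theorem mono_zero_zero : mono U 0 0 = 1 := by simp [mono]

theorem mono_mul (i j a b : ℕ) : mono U i j * mono U a b = mono U (i + a) (j + b) := by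
  simp only [mono, pow_add]; ring

theorem dx_mono (i j : ℕ) : dx U (mono U i j) = (i : ℂ) • mono U (i - 1) j := by
  have h := coordDeriv_pow_mul_pow (1, 0) (cx U) (cy U) i j
  rwa [show coordDeriv U (1, 0) (cx U) = 1 from dx_cx,
    show coordDeriv U (1, 0) (cy U) = 0 from dx_cy, mul_one, mul_zero, smul_zero, add_zero] at h

theorem dy_mono (i j : ℕ) : dy U (mono U i j) = (j : ℂ) • mono U i (j - 1) := by
  have h := coordDeriv_pow_mul_pow (0, 1) (cx U) (cy U) i j
  rwa [show coordDeriv U (0, 1) (cx U) = 0 from dy_cx,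
    show coordDeriv U (0, 1) (cy U) = 1 from dy_cy, mul_one, mul_zero, smul_zero, zero_add] at h

theorem dx_pow_mono (s i j : ℕ) :
    (dx U ^ s) (mono U i j) = (i.descFactorial s : ℂ) • mono U (i - s) j := by
  induction s with
  | zero => simp
  | succ s ih =>
    rw [pow_succ', Module.End.mul_apply, ih, map_smul, dx_mono, Nat.descFactorial_succ, smul_smul,
      Nat.sub_sub]
    push_cast
    ring_nf

theorem dy_pow_mono (s i j : ℕ) :
    (dy U ^ s) (mono U i j) = (j.descFactorial s : ℂ) • mono U i (j - s) := by
  induction s with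
  | zero => simp
  | succ s ih =>
    rw [pow_succ', Module.End.mul_apply, ih, map_smul, dy_mono, Nat.descFactorial_succ, smul_smul,
      Nat.sub_sub]
    push_cast
    ring_nf

theorem mulOp_apply (f g : Smooth U) : mulOp U f g = f * g := rfl

theorem mulOp_eq_lmul : mulOp U = Algebra.lmul ℂ (Smooth U) := rfl

theorem diffMonomial_apply_mono (f : Smooth U) (s t i j : ℕ) :
    (mulOp U f * dx U ^ s * dy U ^ t) (mono U i j)
      = ((i.descFactorial s * j.descFactorial t : ℕ) : ℂ) • (f * mono U (i - s) (j - t)) := by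
  rw [Module.End.mul_apply, Module.End.mul_apply, dy_pow_mono, map_smul, dx_pow_mono, mulOp_apply,
    smul_smul, mul_smul_comm]
  push_cast
  ring_nf

/-! ### The order filtration -/

/-- The operators of order at most `k`, as a subspace. -/
def orderLE (U : Opens (ℂ × ℂ)) (k : ℕ) : Submodule ℂ (Module.End ℂ (Smooth U)) where
  carrier := {T | HasOrderLE U k T}
  add_mem' := by
    rintro _ _ ⟨f, rfl⟩ ⟨g, rfl⟩
    exact ⟨f + g, by
      simp only [← Finset.sum_add_distrib, Pi.add_apply, mulOp_eq_lmul, map_add, add_mul]⟩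
  zero_mem' := ⟨0, by simp [mulOp_eq_lmul]⟩
  smul_mem' := by
    rintro c _ ⟨f, rfl⟩
    exact ⟨c • f, by
      simp only [Finset.smul_sum, Pi.smul_apply, mulOp_eq_lmul, map_smul, smul_mul_assoc]⟩

theorem diffMonomial_mem_orderLE {k s t : ℕ} (h : s + t ≤ k) (f : Smooth U) :
    mulOp U f * dx U ^ s * dy U ^ t ∈ orderLE U k := by
  refine ⟨fun a b => if a = s ∧ b = t then f else 0, ?_⟩
  rw [Finset.sum_eq_single_of_mem s (Finset.mem_range.2 (by omega)),
    Finset.sum_eq_single_of_mem t (Finset.mem_range.2 (by omega))]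
  · simp
  · intro b _ hb
    simp [hb, mulOp_eq_lmul]
  · intro b _ hb
    simp [hb, mulOp_eq_lmul]

theorem orderLE_le_iff {k : ℕ} {M : Submodule ℂ (Module.End ℂ (Smooth U))} :
    orderLE U k ≤ M ↔
      ∀ (f : Smooth U) (s t : ℕ), s + t ≤ k → mulOp U f * dx U ^ s * dy U ^ t ∈ M := by
  refine ⟨fun h f s t hst => h (diffMonomial_mem_orderLE hst f), fun h => ?_⟩
  rintro _ ⟨f, rfl⟩
  refine sum_mem fun s hs => sum_mem fun t ht => h _ _ _ ?_
  rw [Finset.mem_range] at hs ht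
  omega

theorem orderLE_mono {k l : ℕ} (h : k ≤ l) : orderLE U k ≤ orderLE U l :=
  orderLE_le_iff.2 fun f _ _ hst => diffMonomial_mem_orderLE (hst.trans h) f

theorem coordDeriv_mul_mulOp (v : ℂ × ℂ) (f : Smooth U) :
    coordDeriv U v * mulOp U f = mulOp U f * coordDeriv U v + mulOp U (coordDeriv U v f) := by
  ext1 g
  simp only [Module.End.mul_apply, LinearMap.add_apply, mulOp_apply, coordDeriv_mul]
  ring

theorem dx_mul_mem_orderLE {k : ℕ} {T : Module.End ℂ (Smooth U)} (hT : T ∈ orderLE U k) :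
    dx U * T ∈ orderLE U (k + 1) := by
  have h : orderLE U k ≤ (orderLE U (k + 1)).comap (LinearMap.mulLeft ℂ (dx U)) := by
    refine orderLE_le_iff.2 fun f s t hst => ?_
    rw [Submodule.mem_comap, LinearMap.mulLeft_apply, ← mul_assoc, ← mul_assoc, dx,
      coordDeriv_mul_mulOp, ← dx, add_mul, add_mul, mul_assoc (mulOp U f), ← pow_succ']
    exact add_mem (diffMonomial_mem_orderLE (by omega) _) (diffMonomial_mem_orderLE (by omega) _)
  exact h hT

theorem dy_mul_mem_orderLE {k : ℕ} {T : Module.End ℂ (Smooth U)} (hT : T ∈ orderLE U k) :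
    dy U * T ∈ orderLE U (k + 1) := by
  have h : orderLE U k ≤ (orderLE U (k + 1)).comap (LinearMap.mulLeft ℂ (dy U)) := by
    refine orderLE_le_iff.2 fun f s t hst => ?_
    have comm : dy U * dx U ^ s = dx U ^ s * dy U := ((coordDeriv_comm _ _).pow_right s).eq
    rw [Submodule.mem_comap, LinearMap.mulLeft_apply, ← mul_assoc, ← mul_assoc, dy,
      coordDeriv_mul_mulOp, ← dy, add_mul, add_mul, mul_assoc (mulOp U f), comm, ← mul_assoc,
      mul_assoc _ (dy U), ← pow_succ']
    exact add_mem (diffMonomial_mem_orderLE (by omega) _) (diffMonomial_mem_orderLE (by omega) _)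
  exact h hT

theorem mulOp_mul_mem_orderLE {k : ℕ} (g : Smooth U) {T : Module.End ℂ (Smooth U)}
    (hT : T ∈ orderLE U k) : mulOp U g * T ∈ orderLE U k := by
  have h : orderLE U k ≤ (orderLE U k).comap (LinearMap.mulLeft ℂ (mulOp U g)) := by
    refine orderLE_le_iff.2 fun f s t hst => ?_
    rw [Submodule.mem_comap, LinearMap.mulLeft_apply, ← mul_assoc, ← mul_assoc, mulOp_eq_lmul,
      ← map_mul]
    exact diffMonomial_mem_orderLE hst _
  exact h hT

theorem mul_mem_orderLE {k l : ℕ} {T T' : Module.End ℂ (Smooth U)}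
    (hT : T ∈ orderLE U k) (hT' : T' ∈ orderLE U l) : T * T' ∈ orderLE U (k + l) := by
  have dy_pow_mul_mem (t : ℕ) : dy U ^ t * T' ∈ orderLE U (l + t) := by
    induction t with
    | zero => simpa using hT'
    | succ t ih => rw [pow_succ', mul_assoc]; exact dy_mul_mem_orderLE ih
  have dx_pow_mul_mem (s t : ℕ) : dx U ^ s * (dy U ^ t * T') ∈ orderLE U (l + t + s) := by
    induction s with
    | zero => simpa using dy_pow_mul_mem t
    | succ s ih => rw [pow_succ', mul_assoc]; exact dx_mul_mem_orderLE ih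
  have h : orderLE U k ≤ (orderLE U (k + l)).comap (LinearMap.mulRight ℂ T') := by
    refine orderLE_le_iff.2 fun f s t hst => ?_
    rw [Submodule.mem_comap, LinearMap.mulRight_apply, mul_assoc, mul_assoc]
    exact orderLE_mono (by omega) (mulOp_mul_mem_orderLE f (dx_pow_mul_mem s t))
  exact h hT

theorem mulOp_mem_orderLE (f : Smooth U) : mulOp U f ∈ orderLE U 0 := by
  simpa using diffMonomial_mem_orderLE (s := 0) (t := 0) le_rfl f

theorem one_mem_orderLE : (1 : Module.End ℂ (Smooth U)) ∈ orderLE U 0 := by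
  rw [← map_one (Algebra.lmul ℂ (Smooth U)), ← mulOp_eq_lmul]
  exact mulOp_mem_orderLE 1

theorem dx_mem_orderLE : dx U ∈ orderLE U 1 := by
  simpa using dx_mul_mem_orderLE (one_mem_orderLE (U := U))

theorem dy_mem_orderLE : dy U ∈ orderLE U 1 := by
  simpa using dy_mul_mem_orderLE (one_mem_orderLE (U := U))

/-! ### Recovering the coefficients from the values on monomials -/

theorem coeff_mem_of_apply_mono_mem {N : ℕ → ℕ → Submodule ℂ (Smooth U)}
    (hN : ∀ (s t i j : ℕ), ∀ f ∈ N s t, f * mono U i j ∈ N (s + i) (t + j)) {k : ℕ}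
    {f : ℕ → ℕ → Smooth U}
    (h : ∀ i j : ℕ, i + j ≤ k → (∑ s ∈ Finset.range (k + 1), ∑ t ∈ Finset.range (k + 1 - s),
      mulOp U (f s t) * dx U ^ s * dy U ^ t) (mono U i j) ∈ N i j) (i j : ℕ) (hij : i + j ≤ k) :
    f i j ∈ N i j := by
  induction hm : i + j using Nat.strong_induction_on generalizing i j with
  | _ m ih =>
    subst hm
    have value_mem := h i j hij
    rw [Finset.sum_sigma', LinearMap.sum_apply,
      ← Finset.add_sum_erase _ _ (a := (⟨i, j⟩ : (_ : ℕ) × ℕ))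
        (by simp only [Finset.mem_sigma, Finset.mem_range]; omega)] at value_mem
    have leading_mem := (Submodule.add_mem_iff_left _ (Submodule.sum_mem _ ?_)).1 value_mem
    · rw [diffMonomial_apply_mono, Nat.sub_self, Nat.sub_self, mono_zero_zero, mul_one,
        Nat.descFactorial_self, Nat.descFactorial_self] at leading_mem
      exact (Submodule.smul_mem_iff _ (Nat.cast_ne_zero.2 (by positivity))).1 leading_mem
    · rintro ⟨s, t⟩ hst
      simp only [Finset.mem_erase, Finset.mem_sigma, Finset.mem_range, ne_eq, Sigma.mk.injEq,
        heq_eq_eq] at hst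
      simp only [diffMonomial_apply_mono]
      rcases lt_or_ge i s with his | hsi
      · simp [Nat.descFactorial_of_lt his]
      rcases lt_or_ge j t with hjt | htj
      · simp [Nat.descFactorial_of_lt hjt]
      have := hN s t (i - s) (j - t) _ (ih (s + t) (by omega) s t (by omega) rfl)
      rw [Nat.add_sub_cancel' hsi, Nat.add_sub_cancel' htj] at this
      exact Submodule.smul_mem _ _ this

theorem eq_zero_of_apply_mono {k : ℕ} {T : Module.End ℂ (Smooth U)} (hT : T ∈ orderLE U k)
    (h : ∀ i j : ℕ, T (mono U i j) = 0) : T = 0 := by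
  obtain ⟨f, rfl⟩ := hT
  have coeff_mem_bot := coeff_mem_of_apply_mono_mem (N := fun _ _ => ⊥) (k := k) (f := f)
    (by simp) (fun i j _ => (Submodule.mem_bot ℂ).2 (h i j))
  refine Finset.sum_eq_zero fun s hs => Finset.sum_eq_zero fun t ht => ?_
  rw [Finset.mem_range] at hs ht
  rw [(Submodule.mem_bot ℂ).1 (coeff_mem_bot s t (by omega)), mulOp_eq_lmul, map_zero, zero_mul,
    zero_mul]

/-! ### Linear independence of the monomials -/

theorem mono_ne_zero [Nonempty U] (i j : ℕ) : mono U i j ≠ 0 := by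
  intro h
  have key := diffMonomial_apply_mono (1 : Smooth U) i j i j
  rw [h, map_zero, Nat.sub_self, Nat.sub_self, mono_zero_zero, Nat.descFactorial_self,
    Nat.descFactorial_self, mul_one] at key
  exact smul_ne_zero (Nat.cast_ne_zero.2 (by positivity)) one_ne_zero key.symm

theorem cx_mul_dx_mono (i j : ℕ) : cx U * dx U (mono U i j) = (i : ℂ) • mono U i j := by
  rw [dx_mono]
  rcases i with _ | i
  · simp
  · rw [Nat.add_sub_cancel, mul_smul_comm, mono, mono, pow_succ', mul_assoc]

theorem cy_mul_dy_mono (i j : ℕ) : cy U * dy U (mono U i j) = (j : ℂ) • mono U i j := by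
  rw [dy_mono]
  rcases j with _ | j
  · simp
  · rw [Nat.add_sub_cancel, mul_smul_comm, mono, mono, pow_succ', mul_left_comm]

theorem linearIndependent_mono [Nonempty U] :
    LinearIndependent ℂ (fun e : ℕ × ℕ => mono U e.1 e.2) := by
  -- The monomials are eigenvectors of `x∂_x + i y∂_y` for pairwise different eigenvalues.
  refine Module.End.eigenvectors_linearIndependent'
    (mulOp U (cx U) * dx U + Complex.I • (mulOp U (cy U) * dy U))
    (fun e : ℕ × ℕ => (e.1 : ℂ) + Complex.I * e.2) ?_ _ (fun e => ⟨?_, mono_ne_zero _ _⟩)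
  · rintro ⟨a, b⟩ ⟨c, d⟩ h
    simpa [Complex.ext_iff] using h
  · rw [Module.End.mem_eigenspace_iff, LinearMap.add_apply, LinearMap.smul_apply,
      Module.End.mul_apply, Module.End.mul_apply, mulOp_apply, mulOp_apply, cx_mul_dx_mono,
      cy_mul_dy_mono, smul_smul, ← add_smul]

/-- The coefficient functionals `f ↦ [x^i y^j] f`, extended linearly (in some way) from the
polynomials to all smooth functions. -/
def monoCoeff (U : Opens (ℂ × ℂ)) : Smooth U →ₗ[ℂ] (ℕ × ℕ →₀ ℂ) :=
  (Finsupp.linearCombination ℂ fun e : ℕ × ℕ => mono U e.1 e.2).leftInverse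

theorem monoCoeff_mono [Nonempty U] (i j : ℕ) :
    monoCoeff U (mono U i j) = Finsupp.single (i, j) 1 := by
  have h := LinearMap.leftInverse_apply_of_inj
    (LinearMap.ker_eq_bot.2 (linearIndependent_mono (U := U))) (Finsupp.single (i, j) 1)
  rwa [Finsupp.linearCombination_single, one_smul] at h

open MvPolynomial

/-! ### Bidegrees -/

theorem triModule_eq_span_image (m : ℕ) : triModule U m
    = Submodule.span ℂ ((fun e : ℕ × ℕ => mono U e.1 e.2) '' {e | e.1 + e.2 ≤ m}) := by
  rw [triModule]
  congr 1
  ext f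
  simp [mono, eq_comm]

theorem monomialLine_eq_span_image (i j : ℤ) : monomialLine U i j = Submodule.span ℂ
    ((fun e : ℕ × ℕ => mono U e.1 e.2) '' {e | (e.1 : ℤ) = i ∧ (e.2 : ℤ) = j}) := by
  rw [monomialLine]
  congr 1
  ext f
  simp [mono, eq_comm, and_assoc]

theorem mono_mem_triModule {i j m : ℕ} (h : i + j ≤ m) : mono U i j ∈ triModule U m :=
  Submodule.subset_span ⟨i, j, h, rfl⟩

theorem mem_monomialLine_iff {i j : ℤ} {f : Smooth U} : f ∈ monomialLine U i j ↔
    ∃ c : ℂ, (c ≠ 0 → 0 ≤ i ∧ 0 ≤ j) ∧ f = c • mono U i.toNat j.toNat := by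
  refine ⟨fun hf => ?_, ?_⟩
  · by_cases hij : 0 ≤ i ∧ 0 ≤ j
    · lift i to ℕ using hij.1
      lift j to ℕ using hij.2
      have image_eq : {e : ℕ × ℕ | (e.1 : ℤ) = i ∧ (e.2 : ℤ) = j} = {(i, j)} := by
        ext e
        simp [Prod.ext_iff]
      rw [monomialLine_eq_span_image, image_eq, Set.image_singleton,
        Submodule.mem_span_singleton] at hf
      obtain ⟨c, rfl⟩ := hf
      exact ⟨c, fun _ => hij, rfl⟩
    · have image_eq : {e : ℕ × ℕ | (e.1 : ℤ) = i ∧ (e.2 : ℤ) = j} = ∅ :=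
        Set.eq_empty_of_forall_notMem fun e he => hij (by rw [← he.1, ← he.2]; simp)
      rw [monomialLine_eq_span_image, image_eq, Set.image_empty, Submodule.span_empty,
        Submodule.mem_bot] at hf
      exact ⟨0, fun h => absurd rfl h, by rw [hf, zero_smul]⟩
  · rintro ⟨c, hc, rfl⟩
    rcases eq_or_ne c 0 with rfl | h0
    · rw [zero_smul]; exact zero_mem _
    · exact Submodule.smul_mem _ _ (Submodule.subset_span
        ⟨_, _, Int.toNat_of_nonneg (hc h0).1, Int.toNat_of_nonneg (hc h0).2, rfl⟩)

theorem mul_mono_mem_monomialLine {i j : ℤ} {f : Smooth U} (hf : f ∈ monomialLine U i j)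
    (a b : ℕ) : f * mono U a b ∈ monomialLine U (i + a) (j + b) := by
  obtain ⟨c, hc, rfl⟩ := mem_monomialLine_iff.1 hf
  refine mem_monomialLine_iff.2 ⟨c, fun h => by have := hc h; omega, ?_⟩
  rcases eq_or_ne c 0 with rfl | h0
  · simp
  · obtain ⟨hi, hj⟩ := hc h0
    rw [smul_mul_assoc, mono_mul, Int.toNat_add hi (by omega), Int.toNat_add hj (by omega),
      Int.toNat_natCast, Int.toNat_natCast]

theorem monoCoeff_mem_supported [Nonempty U] {s : Set (ℕ × ℕ)} {f : Smooth U}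
    (hf : f ∈ Submodule.span ℂ ((fun e : ℕ × ℕ => mono U e.1 e.2) '' s)) :
    monoCoeff U f ∈ Finsupp.supported ℂ ℂ s := by
  suffices h : Submodule.span ℂ ((fun e : ℕ × ℕ => mono U e.1 e.2) '' s)
      ≤ (Finsupp.supported ℂ ℂ s).comap (monoCoeff U) from h hf
  rw [Submodule.span_le]
  rintro _ ⟨e, he, rfl⟩
  rw [SetLike.mem_coe, Submodule.mem_comap, monoCoeff_mono]
  exact Finsupp.single_mem_supported ℂ _ he

theorem monoCoeff_eq_zero [Nonempty U] {s : Set (ℕ × ℕ)} {f : Smooth U}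
    (hf : f ∈ Submodule.span ℂ ((fun e : ℕ × ℕ => mono U e.1 e.2) '' s)) {e : ℕ × ℕ}
    (he : e ∉ s) : monoCoeff U f e = 0 :=
  (Finsupp.mem_supported' ℂ _).1 (monoCoeff_mem_supported hf) e he

theorem mem_triModule_of_sum_mem [Nonempty U] {F : Finset (ℤ × ℤ)} {g : ℤ × ℤ → Smooth U}
    (hg : ∀ e ∈ F, g e ∈ monomialLine U e.1 e.2) {m : ℕ} (h : ∑ e ∈ F, g e ∈ triModule U m)
    {e : ℤ × ℤ} (he : e ∈ F) : g e ∈ triModule U m := by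
  obtain ⟨c, hc, g_eq⟩ := mem_monomialLine_iff.1 (hg e he)
  rcases eq_or_ne c 0 with rfl | h0
  · rw [g_eq, zero_smul]; exact zero_mem _
  obtain ⟨hi, hj⟩ := hc h0
  rw [g_eq]
  refine Submodule.smul_mem _ _ (mono_mem_triModule ?_)
  by_contra hlt
  have sum_coeff := monoCoeff_eq_zero (e := (e.1.toNat, e.2.toNat))
    (by rwa [triModule_eq_span_image] at h) hlt
  rw [map_sum, Finsupp.finsetSum_apply, Finset.sum_eq_single_of_mem e he, g_eq, map_smul,
    monoCoeff_mono, Finsupp.smul_apply, Finsupp.single_eq_same, smul_eq_mul, mul_one] at sum_coeff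
  · exact h0 sum_coeff
  · intro e' he' hne
    have hmem := hg e' he'
    rw [monomialLine_eq_span_image] at hmem
    refine monoCoeff_eq_zero hmem fun ⟨h₁, h₂⟩ => hne (Prod.ext ?_ ?_)
    · rw [← h₁, Int.toNat_of_nonneg hi]
    · rw [← h₂, Int.toNat_of_nonneg hj]

/-- The operators that map each `x^i y^j` to a multiple of `x^{i + d₁} y^{j + d₂}`. -/
def bidegree (U : Opens (ℂ × ℂ)) (d : ℤ × ℤ) : Submodule ℂ (Module.End ℂ (Smooth U)) where
  carrier := {E | ∀ i j : ℕ, E (mono U i j) ∈ monomialLine U (i + d.1) (j + d.2)}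
  add_mem' hE hE' i j := add_mem (hE i j) (hE' i j)
  zero_mem' _ _ := zero_mem _
  smul_mem' c _ hE i j := Submodule.smul_mem _ c (hE i j)

theorem exists_apply_mono_eq_smul {d : ℤ × ℤ} {E : Module.End ℂ (Smooth U)}
    (hE : E ∈ bidegree U d) (i j : ℕ) : ∃ c : ℂ, (c ≠ 0 → 0 ≤ i + d.1 ∧ 0 ≤ j + d.2) ∧
      E (mono U i j) = c • mono U (i + d.1).toNat (j + d.2).toNat :=
  mem_monomialLine_iff.1 (hE i j)

theorem one_mem_bidegree : (1 : Module.End ℂ (Smooth U)) ∈ bidegree U 0 := fun i j =>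
  mem_monomialLine_iff.2 ⟨1, by simp, by simp⟩

theorem mul_mem_bidegree {d d' : ℤ × ℤ} {E E' : Module.End ℂ (Smooth U)}
    (hE : E ∈ bidegree U d) (hE' : E' ∈ bidegree U d') : E * E' ∈ bidegree U (d + d') := by
  intro i j
  obtain ⟨c, hc, E'_apply⟩ := exists_apply_mono_eq_smul hE' i j
  rw [Module.End.mul_apply, E'_apply, map_smul]
  rcases eq_or_ne c 0 with rfl | h0
  · rw [zero_smul]; exact zero_mem _
  · obtain ⟨hi, hj⟩ := hc h0
    have h := hE (i + d'.1).toNat (j + d'.2).toNat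
    rw [Int.toNat_of_nonneg hi, Int.toNat_of_nonneg hj, add_assoc, add_assoc, add_comm d'.1,
      add_comm d'.2] at h
    exact Submodule.smul_mem _ c h

/-! ### Symbols -/

/-- `p` is the symbol of the operator `E` of bidegree `d`:
`E (x^i y^j) = p(i, j) x^{i + d₁} y^{j + d₂}`. Divisibility by the falling factors makes `p(i, j)`
vanish where `i + d₁` or `j + d₂` is negative, so that the truncation `Int.toNat` is harmless. -/
structure IsSymbol (E : Module.End ℂ (Smooth U)) (d : ℤ × ℤ) (p : MvPolynomial (Fin 2) ℂ) :
    Prop where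
  apply_mono (i j : ℕ) :
    E (mono U i j) = eval ![(i : ℂ), (j : ℂ)] p • mono U (i + d.1).toNat (j + d.2).toNat
  dvd : fallingFactor ℂ (-d.1).toNat (-d.2).toNat ∣ p

namespace IsSymbol

variable {E E' : Module.End ℂ (Smooth U)} {d : ℤ × ℤ} {p p' : MvPolynomial (Fin 2) ℂ}

theorem nonneg_of_eval_ne_zero (h : IsSymbol E d p) {i j : ℕ}
    (h0 : eval ![(i : ℂ), (j : ℂ)] p ≠ 0) : 0 ≤ i + d.1 ∧ 0 ≤ j + d.2 := by
  obtain ⟨q, rfl⟩ := h.dvd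
  rw [map_mul, eval_fallingFactor] at h0
  have hne := Nat.cast_ne_zero.1 (left_ne_zero_of_mul h0)
  have hi := mt Nat.descFactorial_eq_zero_iff_lt.2 (left_ne_zero_of_mul hne)
  have hj := mt Nat.descFactorial_eq_zero_iff_lt.2 (right_ne_zero_of_mul hne)
  omega

theorem mem_bidegree (h : IsSymbol E d p) : E ∈ bidegree U d := fun i j =>
  mem_monomialLine_iff.2 ⟨_, h.nonneg_of_eval_ne_zero, h.apply_mono i j⟩

theorem zero : IsSymbol (0 : Module.End ℂ (Smooth U)) d 0 := ⟨by simp, dvd_zero _⟩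

theorem add (h : IsSymbol E d p) (h' : IsSymbol E' d p') : IsSymbol (E + E') d (p + p') :=
  ⟨fun i j => by rw [LinearMap.add_apply, h.apply_mono, h'.apply_mono, map_add, add_smul],
    dvd_add h.dvd h'.dvd⟩

theorem smul (c : ℂ) (h : IsSymbol E d p) : IsSymbol (c • E) d (c • p) :=
  ⟨fun i j => by rw [LinearMap.smul_apply, h.apply_mono, smul_eval, smul_smul],
    h.dvd.trans (dvd_smul_of_dvd c dvd_rfl)⟩

theorem sum {ι : Type*} {s : Finset ι} {E : ι → Module.End ℂ (Smooth U)}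
    {p : ι → MvPolynomial (Fin 2) ℂ} (h : ∀ i ∈ s, IsSymbol (E i) d (p i)) :
    IsSymbol (∑ i ∈ s, E i) d (∑ i ∈ s, p i) := by
  classical
  induction s using Finset.induction_on with
  | empty => simpa using zero
  | insert i s hi ih =>
    rw [Finset.sum_insert hi, Finset.sum_insert hi]
    exact (h i (Finset.mem_insert_self i s)).add
      (ih fun i' hi' => h i' (Finset.mem_insert_of_mem hi'))

theorem of_apply_mono (h : ∀ i j : ℕ, E (mono U i j) = eval ![(i : ℂ), (j : ℂ)] p • mono U i j) :
    IsSymbol E 0 p :=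
  ⟨fun i j => by simpa using h i j, by simp [fallingFactor]⟩

theorem mulOp_mono_mul (a b : ℕ) (h : IsSymbol E 0 p) :
    IsSymbol (mulOp U (mono U a b) * E) (a, b) p := by
  refine ⟨fun i j => ?_, by simp [fallingFactor]⟩
  rw [Module.End.mul_apply, h.apply_mono, mulOp_apply, mul_smul_comm, mono_mul]
  congr 2
  · simp only [Prod.fst_zero]; omega
  · simp only [Prod.snd_zero]; omega

theorem mul_diag {q : MvPolynomial (Fin 2) ℂ} (h : IsSymbol E d p) (h' : IsSymbol E' 0 q) :
    IsSymbol (E * E') d (p * q) := by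
  refine ⟨fun i j => ?_, h.dvd.mul_right q⟩
  rw [Module.End.mul_apply, h'.apply_mono, map_smul, map_mul, mul_comm (eval _ p), ← smul_smul]
  simpa using congrArg _ (h.apply_mono i j)

theorem mul_diag_pow {q : MvPolynomial (Fin 2) ℂ} (h : IsSymbol E d p) (h' : IsSymbol E' 0 q)
    (s : ℕ) : IsSymbol (E * E' ^ s) d (p * q ^ s) := by
  induction s with
  | zero => simpa using h
  | succ s ih =>
    rw [pow_succ, pow_succ, ← mul_assoc, ← mul_assoc]
    exact ih.mul_diag h'

theorem eq_of_symbol_eq {k l : ℕ} (hE : E ∈ orderLE U k) (hE' : E' ∈ orderLE U l)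
    (h : IsSymbol E d p) (h' : IsSymbol E' d p) : E = E' := by
  have diff_eq_zero : E + (-1 : ℂ) • E' = 0 :=
    eq_zero_of_apply_mono (k := max k l) (add_mem (orderLE_mono (le_max_left k l) hE)
      (Submodule.smul_mem _ _ (orderLE_mono (le_max_right k l) hE'))) fun i j => by
        rw [(h.add (h'.smul (-1))).apply_mono]
        simp
  ext1 f
  have diff_apply := LinearMap.congr_fun diff_eq_zero f
  rwa [LinearMap.add_apply, LinearMap.smul_apply, neg_one_smul, LinearMap.zero_apply,
    add_neg_eq_zero] at diff_apply

end IsSymbol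

theorem isSymbol_diffMonomial (a b s t : ℕ) :
    IsSymbol (mulOp U (mono U a b) * dx U ^ s * dy U ^ t) ((a : ℤ) - s, (b : ℤ) - t)
      (fallingFactor ℂ s t) := by
  refine ⟨fun i j => ?_, fallingFactor_dvd_fallingFactor ?_ ?_⟩
  · rw [diffMonomial_apply_mono, eval_fallingFactor, mono_mul]
    by_cases hst : s ≤ i ∧ t ≤ j
    · congr 2
      · simp only; omega
      · simp only; omega
    · have coeff_eq_zero : i.descFactorial s * j.descFactorial t = 0 := by
        rcases not_and_or.1 hst with h | h <;>
          simp [Nat.descFactorial_eq_zero_iff_lt.2 (not_le.1 h)]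
      rw [coeff_eq_zero, Nat.cast_zero, zero_smul, zero_smul]
  · simp only; omega
  · simp only; omega

theorem exists_isSymbol {k : ℕ} {d : ℤ × ℤ} {E : Module.End ℂ (Smooth U)}
    (hE : E ∈ orderLE U k) (hEd : E ∈ bidegree U d) : ∃ p, p.totalDegree ≤ k ∧ IsSymbol E d p := by
  obtain ⟨f, rfl⟩ := hE
  have coeff_mem := coeff_mem_of_apply_mono_mem
    (N := fun s t => monomialLine U (s + d.1) (t + d.2))
    (fun s t i j f hf => by
      convert mul_mono_mem_monomialLine hf i j using 1
      push_cast
      ring_nf)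
    (fun i j _ => hEd i j)
  have coeff_symbol (s t : ℕ) (hst : s + t ≤ k) :
      ∃ c : ℂ, IsSymbol (mulOp U (f s t) * dx U ^ s * dy U ^ t) d (c • fallingFactor ℂ s t) := by
    obtain ⟨c, hc, f_eq⟩ := mem_monomialLine_iff.1 (coeff_mem s t hst)
    refine ⟨c, ?_⟩
    rw [f_eq, mulOp_eq_lmul, map_smul, smul_mul_assoc, smul_mul_assoc, ← mulOp_eq_lmul]
    rcases eq_or_ne c 0 with rfl | h0
    · rw [zero_smul, zero_smul]; exact .zero
    · convert (isSymbol_diffMonomial (s + d.1).toNat (t + d.2).toNat s t).smul c using 1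
      have := hc h0
      ext <;> simp only <;> omega
  choose! c hc using coeff_symbol
  refine ⟨∑ s ∈ Finset.range (k + 1), ∑ t ∈ Finset.range (k + 1 - s), c s t • fallingFactor ℂ s t,
    totalDegree_finsetSum_le fun s hs => totalDegree_finsetSum_le fun t ht => ?_,
    .sum fun s hs => .sum fun t ht => hc s t ?_⟩ <;> rw [Finset.mem_range] at hs ht
  · exact (totalDegree_smul_le _ _).trans ((totalDegree_fallingFactor s t).trans_le (by omega))
  · omega

/-! ### Homogeneous components -/

/-- The span of all monomials `x^i y^j`. -/
def polySpan (U : Opens (ℂ × ℂ)) : Submodule ℂ (Smooth U) :=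
  Submodule.span ℂ (Set.range fun e : ℕ × ℕ => mono U e.1 e.2)

theorem mul_mono_mem_polySpan {f : Smooth U} (hf : f ∈ polySpan U) (i j : ℕ) :
    f * mono U i j ∈ polySpan U := by
  suffices h : polySpan U ≤ (polySpan U).comap (LinearMap.mulRight ℂ (mono U i j)) from h hf
  refine Submodule.span_le.2 ?_
  rintro _ ⟨e, rfl⟩
  exact Submodule.subset_span ⟨(e.1 + i, e.2 + j), (mono_mul _ _ _ _).symm⟩

theorem triModule_le_polySpan (m : ℕ) : triModule U m ≤ polySpan U := by
  rw [triModule_eq_span_image]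
  exact Submodule.span_mono (Set.image_subset_range _ _)

theorem mem_iSup_orderLE_inf_bidegree {k : ℕ} {T : Module.End ℂ (Smooth U)} (hT : T ∈ orderLE U k)
    (h : ∀ i j : ℕ, i + j ≤ k → T (mono U i j) ∈ polySpan U) :
    T ∈ ⨆ d, orderLE U k ⊓ bidegree U d := by
  obtain ⟨f, rfl⟩ := hT
  have coeff_mem := coeff_mem_of_apply_mono_mem (fun _ _ i j _ hf => mul_mono_mem_polySpan hf i j) h
  refine sum_mem fun s hs => sum_mem fun t ht => ?_
  rw [Finset.mem_range] at hs ht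
  have polySpan_le : polySpan U ≤ (⨆ d, orderLE U k ⊓ bidegree U d).comap
      (LinearMap.mulRight ℂ (dx U ^ s * dy U ^ t) ∘ₗ (Algebra.lmul ℂ (Smooth U)).toLinearMap) := by
    refine Submodule.span_le.2 ?_
    rintro _ ⟨⟨a, b⟩, rfl⟩
    refine Submodule.mem_iSup_of_mem ((a : ℤ) - s, (b : ℤ) - t) ?_
    change mulOp U (mono U a b) * (dx U ^ s * dy U ^ t) ∈ _
    rw [← mul_assoc]
    exact ⟨diffMonomial_mem_orderLE (by omega) _, (isSymbol_diffMonomial a b s t).mem_bidegree⟩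
  rw [mul_assoc]
  exact polySpan_le (coeff_mem s t (by omega))

/-- `E` maps `𝒯_m` into `𝒯_{m'}`. -/
def MapsTri (m m' : ℕ) (E : Module.End ℂ (Smooth U)) : Prop :=
  ∀ f ∈ triModule U m, E f ∈ triModule U m'

theorem mapsTri_of_apply_mono_mem {m m' : ℕ} {E : Module.End ℂ (Smooth U)}
    (h : ∀ i j : ℕ, i + j ≤ m → E (mono U i j) ∈ triModule U m') : MapsTri m m' E := by
  suffices triModule U m ≤ (triModule U m').comap E from fun f hf => this hf
  refine Submodule.span_le.2 ?_
  rintro _ ⟨i, j, hij, rfl⟩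
  exact h i j hij

theorem MapsTri.of_sum [Nonempty U] {m m' : ℕ} {F : Finset (ℤ × ℤ)}
    {E : ℤ × ℤ → Module.End ℂ (Smooth U)} (hE : ∀ d ∈ F, E d ∈ bidegree U d)
    (h : MapsTri m m' (∑ d ∈ F, E d)) {d : ℤ × ℤ} (hd : d ∈ F) : MapsTri m m' (E d) := by
  refine mapsTri_of_apply_mono_mem fun i j hij => ?_
  let translation : (ℤ × ℤ) ↪ ℤ × ℤ := addLeftEmbedding ((i : ℤ), (j : ℤ))
  have sum_mem := h _ (mono_mem_triModule hij)
  rw [LinearMap.sum_apply] at sum_mem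
  have apply_mem := mem_triModule_of_sum_mem (F := F.map translation)
    (g := fun e => E (e - ((i : ℤ), (j : ℤ))) (mono U i j)) (m := m') (e := translation d)
    (fun e he => by
      obtain ⟨d', hd', rfl⟩ := Finset.mem_map.1 he
      simpa [translation] using hE d' hd' i j)
    (by simpa [translation] using sum_mem) (Finset.mem_map_of_mem _ hd)
  simpa [translation] using apply_mem

theorem exists_homogeneous_decomposition [Nonempty U] {k m m' : ℕ} (hk : k ≤ m)
    {T : Module.End ℂ (Smooth U)} (hT : T ∈ orderLE U k) (hm : MapsTri m m' T) :
    ∃ (F : Finset (ℤ × ℤ)) (E : ℤ × ℤ → Module.End ℂ (Smooth U)), T = ∑ d ∈ F, E d ∧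
      ∀ d ∈ F, E d ∈ orderLE U k ∧ E d ∈ bidegree U d ∧ MapsTri m m' (E d) := by
  have T_mem := mem_iSup_orderLE_inf_bidegree hT fun i j hij =>
    triModule_le_polySpan m' (hm _ (mono_mem_triModule (hij.trans hk)))
  obtain ⟨E, hE, rfl⟩ := (Submodule.mem_iSup_iff_exists_finsupp _ _).1 T_mem
  exact ⟨E.support, E, rfl, fun d hd =>
    ⟨(hE d).1, (hE d).2, MapsTri.of_sum (fun d _ => (hE d).2) hm hd⟩⟩

/-! ### Divisibility of symbols -/

theorem IsSymbol.le_of_eval_ne_zero [Nonempty U] {E : Module.End ℂ (Smooth U)} {d : ℤ × ℤ}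
    {p : MvPolynomial (Fin 2) ℂ} (h : IsSymbol E d p) {m m' : ℕ} (hE : MapsTri m m' E) {i j : ℕ}
    (hij : i + j ≤ m) (h0 : eval ![(i : ℂ), (j : ℂ)] p ≠ 0) : i + j + d.1 + d.2 ≤ m' := by
  have nonneg := h.nonneg_of_eval_ne_zero h0
  have apply_mem := hE _ (mono_mem_triModule hij)
  rw [h.apply_mono, Submodule.smul_mem_iff _ h0, triModule_eq_span_image] at apply_mem
  by_contra hlt
  have := monoCoeff_eq_zero apply_mem (e := ((i + d.1).toNat, (j + d.2).toNat))
    (by simp only [Set.mem_ofPred_eq]; omega)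
  rw [monoCoeff_mono, Finsupp.single_eq_same] at this
  exact one_ne_zero this

/-- The number of lines on which the symbol of an operator `𝒯_m → 𝒯_{m'}` of bidegree `d` has to
vanish. -/
def numLines (m m' : ℕ) (d : ℤ × ℤ) : ℕ :=
  (-d.1).toNat + (-d.2).toNat + ((m : ℤ) - m' + d.1 + d.2).toNat

/-- The product of the equations of the lines on which the symbol of an operator `𝒯_m → 𝒯_{m'}` of
bidegree `d` has to vanish: on the lines `x = q` and `y = q` an exponent would become negative, on
the lines `x + y = m - q` the degree would exceed `m'`. -/
def symbolDivisor (m m' : ℕ) (d : ℤ × ℤ) : MvPolynomial (Fin 2) ℂ :=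
  fallingFactor ℂ (-d.1).toNat (-d.2).toNat *
    diagonalFactor ℂ m ((m : ℤ) - m' + d.1 + d.2).toNat

theorem totalDegree_symbolDivisor (m m' : ℕ) (d : ℤ × ℤ) :
    (symbolDivisor m m' d).totalDegree = numLines m m' d :=
  totalDegree_fallingFactor_mul_diagonalFactor _ _ _ _

theorem IsSymbol.symbolDivisor_dvd [Nonempty U] {E : Module.End ℂ (Smooth U)} {d : ℤ × ℤ}
    {p : MvPolynomial (Fin 2) ℂ} (h : IsSymbol E d p) {m m' : ℕ} (hE : MapsTri m m' E)
    (hp : p.totalDegree ≤ m) : symbolDivisor m m' d ∣ p := by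
  refine fallingFactor_mul_diagonalFactor_dvd hp h.dvd fun i j hij hlt => ?_
  by_contra h0
  have := h.le_of_eval_ne_zero hE hij h0
  omega

theorem IsSymbol.exists_eq_mul_of_totalDegree_le_numLines [Nonempty U]
    {E E₀ : Module.End ℂ (Smooth U)} {d : ℤ × ℤ} {p p₀ : MvPolynomial (Fin 2) ℂ} {m m' : ℕ}
    (h₀ : IsSymbol E₀ d p₀) (hE₀ : MapsTri m m' E₀) (hp₀ : p₀ ≠ 0)
    (hdeg₀ : p₀.totalDegree ≤ numLines m m' d)
    (h : IsSymbol E d p) (hE : MapsTri m m' E) (hp : p ≠ 0) (hdeg : p.totalDegree ≤ m) :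
    ∃ r, p = p₀ * r ∧ numLines m m' d + r.totalDegree ≤ p.totalDegree := by
  have divisor_dvd := h.symbolDivisor_dvd hE hdeg
  have numLines_le := totalDegree_le_of_dvd_of_isDomain divisor_dvd hp
  rw [totalDegree_symbolDivisor] at numLines_le
  have divisor_dvd₀ := h₀.symbolDivisor_dvd hE₀ (hdeg₀.trans (numLines_le.trans hdeg))
  have numLines_le₀ := totalDegree_le_of_dvd_of_isDomain divisor_dvd₀ hp₀
  rw [totalDegree_symbolDivisor] at numLines_le₀
  obtain ⟨r, rfl⟩ := (dvd_of_dvd_of_totalDegree_le divisor_dvd₀ hp₀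
    (by rwa [totalDegree_symbolDivisor])).trans divisor_dvd
  refine ⟨r, rfl, ?_⟩
  rw [totalDegree_mul_of_isDomain hp₀ (right_ne_zero_of_mul hp)]
  exact Nat.add_le_add_right numLines_le₀ _

/-! ### Expansion in the diagonal generators -/

-- `rw [sub_eq_add_neg]` does not unify the additive structures found on `Smooth U`.
theorem sub_smul_eq_add_neg_smul (E F : Module.End ℂ (Smooth U)) (c : ℂ) :
    E - c • F = E + (-c) • F := by
  module

theorem isSymbol_genJ_six (m : ℕ) : IsSymbol (genJ U m 6) 0 (X 0 - C ((m : ℂ) / 3)) :=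
  .of_apply_mono fun i j => by
    change cx U * dx U (mono U i j) - ((m : ℂ) / 3) • mono U i j = _
    rw [cx_mul_dx_mono, ← sub_smul]
    simp

theorem isSymbol_genJ_seven (m : ℕ) : IsSymbol (genJ U m 7) 0 (X 1 - C ((m : ℂ) / 3)) :=
  .of_apply_mono fun i j => by
    change cy U * dy U (mono U i j) - ((m : ℂ) / 3) • mono U i j = _
    rw [cy_mul_dy_mono, ← sub_smul]
    simp

theorem genJ_six_mem_orderLE (m : ℕ) : genJ U m 6 ∈ orderLE U 1 := by
  change mulOp U (cx U) * dx U - ((m : ℂ) / 3) • 1 ∈ orderLE U 1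
  rw [sub_smul_eq_add_neg_smul]
  exact add_mem (mulOp_mul_mem_orderLE _ dx_mem_orderLE)
    (Submodule.smul_mem _ _ (orderLE_mono zero_le_one one_mem_orderLE))

theorem genJ_seven_mem_orderLE (m : ℕ) : genJ U m 7 ∈ orderLE U 1 := by
  change mulOp U (cy U) * dy U - ((m : ℂ) / 3) • 1 ∈ orderLE U 1
  rw [sub_smul_eq_add_neg_smul]
  exact add_mem (mulOp_mul_mem_orderLE _ dy_mem_orderLE)
    (Submodule.smul_mem _ _ (orderLE_mono zero_le_one one_mem_orderLE))

theorem pow_mem_orderLE {k : ℕ} {E : Module.End ℂ (Smooth U)} (hE : E ∈ orderLE U k) (s : ℕ) :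
    E ^ s ∈ orderLE U (s * k) := by
  induction s with
  | zero => rw [pow_zero, zero_mul]; exact one_mem_orderLE
  | succ s ih =>
    rw [pow_succ, Nat.succ_mul]
    exact mul_mem_orderLE ih hE

theorem IsSymbol.mem_span_mul_genJ {k l e : ℕ} {d : ℤ × ℤ} {E E₀ : Module.End ℂ (Smooth U)}
    {p₀ r : MvPolynomial (Fin 2) ℂ} (h₀ : IsSymbol E₀ d p₀) (hE₀ : E₀ ∈ orderLE U l)
    (h : IsSymbol E d (p₀ * r)) (hE : E ∈ orderLE U k) (m : ℕ) (hr : r.totalDegree ≤ e) :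
    E ∈ Submodule.span ℂ
      {G | ∃ i j, i + j ≤ e ∧ G = E₀ * genJ U m 6 ^ i * genJ U m 7 ^ j} := by
  set M := Submodule.span ℂ {G | ∃ i j, i + j ≤ e ∧ G = E₀ * genJ U m 6 ^ i * genJ U m 7 ^ j}
  have M_le : M ≤ orderLE U (l + e) := by
    refine Submodule.span_le.2 ?_
    rintro _ ⟨i, j, hij, rfl⟩
    exact orderLE_mono (by omega) (mul_mem_orderLE (mul_mem_orderLE hE₀
      (pow_mem_orderLE (genJ_six_mem_orderLE m) i)) (pow_mem_orderLE (genJ_seven_mem_orderLE m) j))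
  suffices exists_mem : ∃ G ∈ M, IsSymbol G d (p₀ * r) by
    obtain ⟨G, hG, hGd⟩ := exists_mem
    rwa [h.eq_of_symbol_eq hE (M_le hG) hGd]
  have r_mem := mem_span_prod_X_sub_C (fun _ => (m : ℂ) / 3) hr
  clear h hr
  induction r_mem using Submodule.span_induction with
  | mem r hr =>
    obtain ⟨f, hf, rfl⟩ := hr
    refine ⟨_, Submodule.subset_span ⟨f 0, f 1, ?_, rfl⟩, ?_⟩
    · rwa [Finsupp.degree_eq_sum, Fin.sum_univ_two] at hf
    · rw [Finsupp.prod_fintype _ _ fun _ => pow_zero _, Fin.prod_univ_two, ← mul_assoc]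
      exact (h₀.mul_diag_pow (isSymbol_genJ_six m) _).mul_diag_pow (isSymbol_genJ_seven m) _
  | zero => exact ⟨0, zero_mem _, by rw [mul_zero]; exact .zero⟩
  | add r r' _ _ hr hr' =>
    obtain ⟨G, hG, hGd⟩ := hr
    obtain ⟨G', hG', hGd'⟩ := hr'
    exact ⟨G + G', add_mem hG hG', by rw [mul_add]; exact hGd.add hGd'⟩
  | smul c r _ hr =>
    obtain ⟨G, hG, hGd⟩ := hr
    exact ⟨c • G, Submodule.smul_mem _ _ hG, by rw [mul_smul_comm]; exact hGd.smul c⟩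

/-! ### Homogeneous operators between triangular modules -/

/-- `E` is an operator `𝒯_m → 𝒯_{m'}` of order at most `k` and of bidegree `d` that does not
annihilate `x^i y^j` for large `i`, `j`. The last condition passes to products, and it makes the
bidegree unique. -/
structure IsTriOp (m m' k : ℕ) (d : ℤ × ℤ) (E : Module.End ℂ (Smooth U)) : Prop where
  mem_orderLE : E ∈ orderLE U k
  mem_bidegree : E ∈ bidegree U d
  mapsTri : MapsTri m m' E
  apply_ne_zero : ∃ N : ℕ, ∀ i j : ℕ, N ≤ i → N ≤ j → E (mono U i j) ≠ 0

theorem IsSymbol.isTriOp [Nonempty U] {m m' k : ℕ} {d : ℤ × ℤ} {E : Module.End ℂ (Smooth U)}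
    {p : MvPolynomial (Fin 2) ℂ} (h : IsSymbol E d p) (hE : E ∈ orderLE U k)
    (hle : ∀ i j : ℕ, i + j ≤ m → eval ![(i : ℂ), (j : ℂ)] p ≠ 0 → i + j + d.1 + d.2 ≤ m') (N : ℕ)
    (hp : ∀ i j : ℕ, N ≤ i → N ≤ j → eval ![(i : ℂ), (j : ℂ)] p ≠ 0) : IsTriOp m m' k d E where
  mem_orderLE := hE
  mem_bidegree := h.mem_bidegree
  mapsTri := mapsTri_of_apply_mono_mem fun i j hij => by
    rw [h.apply_mono]
    by_cases h0 : eval ![(i : ℂ), (j : ℂ)] p = 0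
    · rw [h0, zero_smul]; exact zero_mem _
    · have nonneg := h.nonneg_of_eval_ne_zero h0
      have le := hle i j hij h0
      exact Submodule.smul_mem _ _ (mono_mem_triModule (by omega))
  apply_ne_zero := ⟨N, fun i j hi hj => by
    rw [h.apply_mono]
    exact smul_ne_zero (hp i j hi hj) (mono_ne_zero _ _)⟩

theorem isTriOp_one [Nonempty U] (m : ℕ) : IsTriOp m m 0 0 (1 : Module.End ℂ (Smooth U)) where
  mem_orderLE := one_mem_orderLE
  mem_bidegree := one_mem_bidegree
  mapsTri _ hf := hf
  apply_ne_zero := ⟨0, fun i j _ _ => mono_ne_zero i j⟩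

theorem IsTriOp.mul {m₁ m₂ m₃ k l : ℕ} {d d' : ℤ × ℤ} {E E' : Module.End ℂ (Smooth U)}
    (hE : IsTriOp m₂ m₃ k d E) (hE' : IsTriOp m₁ m₂ l d' E') :
    IsTriOp m₁ m₃ (k + l) (d + d') (E * E') where
  mem_orderLE := mul_mem_orderLE hE.mem_orderLE hE'.mem_orderLE
  mem_bidegree := mul_mem_bidegree hE.mem_bidegree hE'.mem_bidegree
  mapsTri f hf := hE.mapsTri _ (hE'.mapsTri f hf)
  apply_ne_zero := by
    obtain ⟨N, hN⟩ := hE.apply_ne_zero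
    obtain ⟨N', hN'⟩ := hE'.apply_ne_zero
    refine ⟨N' + N + d'.1.natAbs + d'.2.natAbs, fun i j hi hj => ?_⟩
    obtain ⟨c, -, E'_apply⟩ := exists_apply_mono_eq_smul hE'.mem_bidegree i j
    have E'_apply_ne_zero := hN' i j (by omega) (by omega)
    rw [Module.End.mul_apply, E'_apply, map_smul]
    rw [E'_apply] at E'_apply_ne_zero
    exact smul_ne_zero (left_ne_zero_of_smul E'_apply_ne_zero) (hN _ _ (by omega) (by omega))

theorem IsTriOp.pow [Nonempty U] {m k : ℕ} {d : ℤ × ℤ} {E : Module.End ℂ (Smooth U)}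
    (hE : IsTriOp m m k d E) (s : ℕ) : IsTriOp m m (s * k) (s • d) (E ^ s) := by
  induction s with
  | zero => simpa using isTriOp_one m
  | succ s ih =>
    rw [pow_succ, Nat.succ_mul, succ_nsmul]
    exact ih.mul hE

theorem isTriOp_prod_ofFn [Nonempty U] {m r : ℕ} {k : Fin r → ℕ} {d : Fin r → ℤ × ℤ}
    {E : Fin r → Module.End ℂ (Smooth U)} (h : ∀ i, IsTriOp m m (k i) (d i) (E i)) :
    IsTriOp m m (∑ i, k i) (∑ i, d i) (List.ofFn E).prod := by
  induction r with
  | zero => simpa using isTriOp_one m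
  | succ r ih =>
    rw [List.ofFn_succ, List.prod_cons, Fin.sum_univ_succ, Fin.sum_univ_succ]
    exact (h 0).mul (ih fun i => h i.succ)

theorem IsTriOp.eq_of_mem_bidegree [Nonempty U] {m m' k : ℕ} {d d' : ℤ × ℤ}
    {E : Module.End ℂ (Smooth U)} (h : IsTriOp m m' k d E) (hd' : E ∈ bidegree U d') : d' = d := by
  obtain ⟨N, hN⟩ := h.apply_ne_zero
  obtain ⟨c, hc, E_apply⟩ := exists_apply_mono_eq_smul h.mem_bidegree N N
  obtain ⟨c', hc', E_apply'⟩ := exists_apply_mono_eq_smul hd' N N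
  have apply_ne_zero := hN N N le_rfl le_rfl
  have nonneg := hc (left_ne_zero_of_smul (E_apply ▸ apply_ne_zero))
  have c'_ne_zero := left_ne_zero_of_smul (E_apply' ▸ apply_ne_zero)
  have nonneg' := hc' c'_ne_zero
  have coeff_eq := congrArg (monoCoeff U) (E_apply'.symm.trans E_apply)
  rw [map_smul, map_smul, monoCoeff_mono, monoCoeff_mono, Finsupp.smul_single_one,
    Finsupp.smul_single_one, Finsupp.single_eq_single_iff] at coeff_eq
  have exponents_eq := Prod.ext_iff.1 (coeff_eq.resolve_right fun h => c'_ne_zero h.1).1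
  ext <;> omega

theorem isTriOp_diffMonomial [Nonempty U] {m m' a b s t : ℕ} (h : m + a + b ≤ m' + s + t) :
    IsTriOp m m' (s + t) ((a : ℤ) - s, (b : ℤ) - t)
      (mulOp U (mono U a b) * dx U ^ s * dy U ^ t) := by
  refine (isSymbol_diffMonomial a b s t).isTriOp (diffMonomial_mem_orderLE le_rfl _)
    (fun i j hij _ => by simp only; omega) (s + t) fun i j hi hj => ?_
  rw [eval_fallingFactor, Nat.cast_ne_zero]
  simp only [ne_eq, mul_eq_zero, Nat.descFactorial_eq_zero_iff_lt]
  omega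

/-- The shifted Euler operator `x∂_x + y∂_y + c`. -/
def eulerOp (U : Opens (ℂ × ℂ)) (c : ℂ) : Module.End ℂ (Smooth U) :=
  mulOp U (cx U) * dx U + mulOp U (cy U) * dy U + c • 1

theorem isSymbol_eulerOp (c : ℂ) : IsSymbol (eulerOp U c) 0 (X 0 + X 1 + C c) :=
  .of_apply_mono fun i j => by
    change cx U * dx U (mono U i j) + cy U * dy U (mono U i j) + c • mono U i j = _
    rw [cx_mul_dx_mono, cy_mul_dy_mono, ← add_smul, ← add_smul]
    simp

theorem eulerOp_mem_orderLE (c : ℂ) : eulerOp U c ∈ orderLE U 1 :=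
  add_mem (add_mem (mulOp_mul_mem_orderLE _ dx_mem_orderLE)
    (mulOp_mul_mem_orderLE _ dy_mem_orderLE))
    (Submodule.smul_mem _ _ (orderLE_mono zero_le_one one_mem_orderLE))

theorem isTriOp_mulOp_mul_eulerOp [Nonempty U] {m m' a b : ℕ} (h : m + a + b ≤ m' + 1) :
    IsTriOp m m' 1 (a, b) (mulOp U (mono U a b) * eulerOp U (-m)) := by
  have eval_eq_zero_iff (i j : ℕ) :
      eval ![(i : ℂ), (j : ℂ)] (X 0 + X 1 + C (-(m : ℂ))) = 0 ↔ i + j = m := by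
    simp [← sub_eq_add_neg, sub_eq_zero, ← Nat.cast_add]
  refine ((isSymbol_eulerOp _).mulOp_mono_mul a b).isTriOp
    (mulOp_mul_mem_orderLE _ (eulerOp_mem_orderLE _)) (fun i j hij h0 => ?_) (m + 1)
    fun i j hi _ => ?_
  · rw [ne_eq, eval_eq_zero_iff] at h0
    simp only
    omega
  · rw [ne_eq, eval_eq_zero_iff]
    omega

theorem natCast_sub_div_three_ne_zero {i m : ℕ} (h : m < i) : (i : ℂ) - (m : ℂ) / 3 ≠ 0 := by
  intro h0
  have three_mul_eq : ((3 * i : ℕ) : ℂ) = m := by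
    push_cast
    linear_combination 3 * h0
  have := Nat.cast_injective three_mul_eq
  omega

theorem mulOp_mono_zero_zero : mulOp U (mono U 0 0) = 1 := by
  rw [mono_zero_zero, mulOp_eq_lmul, map_one]

theorem genJ_zero (m : ℕ) : genJ U m 0 = mulOp U (mono U 1 0) * eulerOp U (-m) := by
  change mulOp U (cx U) ^ 2 * dx U + mulOp U (cx U) * mulOp U (cy U) * dy U
    - (m : ℂ) • mulOp U (cx U) = _
  rw [sub_smul_eq_add_neg_smul, eulerOp, mono, pow_zero, pow_one, mul_one, mul_add, mul_add,
    mul_smul_comm, mul_one, sq, mul_assoc, mul_assoc]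

theorem genJ_one (m : ℕ) : genJ U m 1 = mulOp U (mono U 0 1) * eulerOp U (-m) := by
  change mulOp U (cx U) * mulOp U (cy U) * dx U + mulOp U (cy U) ^ 2 * dy U
    - (m : ℂ) • mulOp U (cy U) = _
  have mulOp_comm : mulOp U (cx U) * mulOp U (cy U) = mulOp U (cy U) * mulOp U (cx U) := by
    rw [mulOp_eq_lmul, ← map_mul, ← map_mul, mul_comm]
  rw [sub_smul_eq_add_neg_smul, eulerOp, mono, pow_zero, pow_one, one_mul, mul_add, mul_add,
    mul_smul_comm, mul_one, sq, mulOp_comm, mul_assoc, mul_assoc]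

/-- The bidegrees of the generators `J¹, …, J⁸`. -/
def genDeg : Fin 8 → ℤ × ℤ :=
  ![(1, 0), (0, 1), (-1, 1), (-1, 0), (0, -1), (1, -1), 0, 0]

theorem isTriOp_genJ [Nonempty U] (m : ℕ) (i : Fin 8) :
    IsTriOp m m 1 (genDeg i) (genJ U m i) := by
  have diffMonomial (a b s t : ℕ) (h : m + a + b ≤ m + s + t) :=
    isTriOp_diffMonomial (U := U) h
  fin_cases i
  · exact genJ_zero (U := U) m ▸ isTriOp_mulOp_mul_eulerOp (a := 1) (b := 0) le_rfl
  · exact genJ_one (U := U) m ▸ isTriOp_mulOp_mul_eulerOp (a := 0) (b := 1) le_rfl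
  · simpa [mono, genDeg, genJ] using diffMonomial 0 1 1 0 (by omega)
  · simpa [mulOp_mono_zero_zero, genDeg, genJ] using diffMonomial 0 0 1 0 (by omega)
  · simpa [mulOp_mono_zero_zero, genDeg, genJ] using diffMonomial 0 0 0 1 (by omega)
  · simpa [mono, genDeg, genJ] using diffMonomial 1 0 0 1 (by omega)
  · refine (isSymbol_genJ_six m).isTriOp (genJ_six_mem_orderLE m) (fun i j hij _ => ?_) (m + 1)
      fun i j hi _ => ?_
    · simpa using by omega
    · simpa using natCast_sub_div_three_ne_zero hi
  · refine (isSymbol_genJ_seven m).isTriOp (genJ_seven_mem_orderLE m) (fun i j hij _ => ?_) (m + 1)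
      fun i j _ hj => ?_
    · simpa using by omega
    · simpa using natCast_sub_div_three_ne_zero hj

theorem isTriOp_prod_eulerOp [Nonempty U] (m l : ℕ) : IsTriOp (m + l) m l 0
    ((List.range l).map fun k => eulerOp U (-((m + k + 1 : ℕ) : ℂ))).prod := by
  induction l with
  | zero => simpa using isTriOp_one m
  | succ l ih =>
    rw [List.range_succ, List.map_append, List.prod_append, List.map_singleton,
      List.prod_singleton, ← add_zero (0 : ℤ × ℤ)]
    refine ih.mul ?_
    have euler := isTriOp_mulOp_mul_eulerOp (U := U) (m := m + l + 1) (a := 0) (b := 0) le_rfl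
    rw [mulOp_mono_zero_zero, one_mul] at euler
    exact euler

theorem qBar_eq {n Δ : ℕ} (hΔ : Δ ≤ n) (α β : ℕ) : qBar U n Δ α β =
    ((List.range (Δ - α - β)).map fun k => eulerOp U (-((n - Δ + k + 1 : ℕ) : ℂ))).prod
      * (dx U ^ α * dy U ^ β) := by
  rw [qBar, mul_assoc]
  congr 3
  funext k
  rw [eulerOp]
  congr 2
  push_cast [Nat.cast_sub hΔ]
  ring

theorem isTriOp_qBar [Nonempty U] {n Δ α β : ℕ} (hΔ : Δ ≤ n) (h : α + β ≤ Δ) :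
    IsTriOp n (n - Δ) Δ (-α, -β) (qBar U n Δ α β) := by
  have euler := isTriOp_prod_eulerOp (U := U) (n - Δ) (Δ - α - β)
  have derivative := isTriOp_diffMonomial (U := U) (a := 0) (b := 0)
    (show n + 0 + 0 ≤ n - Δ + (Δ - α - β) + α + β by omega)
  rw [mulOp_mono_zero_zero, one_mul] at derivative
  rw [qBar_eq hΔ]
  convert euler.mul derivative using 1
  · omega
  · simp

theorem isTriOp_mulOp_mono [Nonempty U] {m m' α β : ℕ} (h : m + α + β ≤ m') :
    IsTriOp m m' 0 (α, β) (mulOp U (mono U α β)) := by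
  simpa using isTriOp_diffMonomial (U := U) (s := 0) (t := 0) h

/-! ### Matrix entries of the monomials -/

/-- The row of the nonzero entry of the monomials of type `ε`. -/
def Kind.row : Kind → Fin 2
  | .one => 0
  | .two => 1
  | .plus => 0
  | .minus => 1

/-- The column of the nonzero entry of the monomials of type `ε`. -/
def Kind.col : Kind → Fin 2
  | .one => 0
  | .two => 1
  | .plus => 1
  | .minus => 0

theorem Kind.exists_row_eq_col_eq (r c : Fin 2) : ∃ ε : Kind, ε.row = r ∧ ε.col = c := by
  fin_cases r <;> fin_cases c
  exacts [⟨.one, rfl, rfl⟩, ⟨.plus, rfl, rfl⟩, ⟨.minus, rfl, rfl⟩, ⟨.two, rfl, rfl⟩]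

/-- The nonzero entry of the prefactor `X_ε`. -/
def prefactorEntry (U : Opens (ℂ × ℂ)) (n Δ : ℕ) : Kind → ℕ → ℕ → Module.End ℂ (Smooth U)
  | .one, _, _ => 1
  | .two, _, _ => 1
  | .plus, α, β => qBar U n Δ α β
  | .minus, α, β => mulOp U (mono U α β)

/-- The bidegree of the prefactor `X_ε`. -/
def prefactorDeg : Kind → ℕ → ℕ → ℤ × ℤ
  | .one, _, _ => 0
  | .two, _, _ => 0
  | .plus, α, β => (-α, -β)
  | .minus, α, β => (α, β)

theorem prefactor_eq_single (n Δ : ℕ) (ε : Kind) (α β : ℕ) :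
    prefactor U n Δ ε α β = Matrix.single ε.row ε.col (prefactorEntry U n Δ ε α β) := by
  cases ε <;> ext1 r c <;> fin_cases r <;> fin_cases c <;> rfl

/-- The nonzero entry of the monomial `T^K_ε`. -/
def monEntry (U : Opens (ℂ × ℂ)) (n Δ : ℕ) (ε : Kind) (m : MonIdx) : Module.End ℂ (Smooth U) :=
  prefactorEntry U n Δ ε m.α m.β *
    (List.ofFn fun i => genJ U (compDeg n Δ ε.col) i ^ m.K i).prod

/-- The bidegree of the monomial `T^K_ε`. -/
def monDeg (ε : Kind) (m : MonIdx) : ℤ × ℤ :=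
  prefactorDeg ε m.α m.β + ∑ i, m.K i • genDeg i

theorem genT_eq_diagonalRingHom (n Δ : ℕ) (i : Fin 8) :
    genT U n Δ i = Matrix.diagonalRingHom (Fin 2) _ fun c => genJ U (compDeg n Δ c) i := by
  ext1 r c
  fin_cases r <;> fin_cases c <;> rfl

theorem single_mul_diagonalRingHom {ι R : Type*} [Fintype ι] [DecidableEq ι]
    [NonAssocSemiring R] (r c : ι) (a : R) (v : ι → R) :
    Matrix.single r c a * Matrix.diagonalRingHom ι R v = Matrix.single r c (a * v c) := by
  ext1 i j
  rw [Matrix.diagonalRingHom_apply, Matrix.mul_diagonal, Matrix.single_apply, Matrix.single_apply]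
  split_ifs with h
  · rw [h.2]
  · rw [zero_mul]

theorem monOp_eq_single (n Δ : ℕ) (ε : Kind) (m : MonIdx) :
    monOp U n Δ ε m = Matrix.single ε.row ε.col (monEntry U n Δ ε m) := by
  have prod_eq : (List.ofFn fun i : Fin 8 => genT U n Δ i ^ m.K i).prod
      = Matrix.diagonalRingHom (Fin 2) _
        (List.ofFn fun i : Fin 8 => (fun c => genJ U (compDeg n Δ c) i) ^ m.K i).prod := by
    rw [map_list_prod, List.map_ofFn]
    simp only [genT_eq_diagonalRingHom, map_pow, Function.comp_def]
  rw [monOp, prefactor_eq_single, prod_eq, single_mul_diagonalRingHom, monEntry]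
  congr 2

theorem monOp_mul_eq_single (n Δ : ℕ) (ε : Kind) (m : MonIdx) (i j : ℕ) :
    monOp U n Δ ε m * genT U n Δ 6 ^ i * genT U n Δ 7 ^ j
      = Matrix.single ε.row ε.col (monEntry U n Δ ε m * genJ U (compDeg n Δ ε.col) 6 ^ i
          * genJ U (compDeg n Δ ε.col) 7 ^ j) := by
  rw [monOp_eq_single, genT_eq_diagonalRingHom, genT_eq_diagonalRingHom, ← map_pow, ← map_pow,
    single_mul_diagonalRingHom, single_mul_diagonalRingHom]
  rfl

theorem isTriOp_prefactorEntry [Nonempty U] {n Δ : ℕ} (hΔ : Δ ≤ n) {ε : Kind} {m : MonIdx}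
    (hm : m.Admissible Δ ε) : IsTriOp (compDeg n Δ ε.col) (compDeg n Δ ε.row) (shift Δ ε)
      (prefactorDeg ε m.α m.β) (prefactorEntry U n Δ ε m.α m.β) := by
  cases ε with
  | one => exact isTriOp_one _
  | two => exact isTriOp_one _
  | plus => exact isTriOp_qBar hΔ hm
  | minus =>
    refine isTriOp_mulOp_mono ?_
    have : m.α + m.β ≤ Δ := hm
    change n - Δ + m.α + m.β ≤ n
    omega

theorem isTriOp_monEntry [Nonempty U] {n Δ : ℕ} (hΔ : Δ ≤ n) {ε : Kind} {m : MonIdx}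
    (hm : m.Admissible Δ ε) : IsTriOp (compDeg n Δ ε.col) (compDeg n Δ ε.row)
      (m.degree + shift Δ ε) (monDeg ε m) (monEntry U n Δ ε m) := by
  have generators :=
    isTriOp_prod_ofFn fun i => (isTriOp_genJ (U := U) (compDeg n Δ ε.col) i).pow (m.K i)
  simp only [mul_one] at generators
  rw [add_comm]
  exact (isTriOp_prefactorEntry hΔ hm).mul generators

/-! ### Short monomials -/

theorem exists_sum_smul_genDeg_eq (d : ℤ × ℤ) :
    ∃ K : Fin 8 → ℕ, ∑ i, K i • genDeg i = d ∧ ∑ i, K i ≤ numLines 0 0 d := by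
  obtain ⟨a, b⟩ := d
  have exponents : ∃ k₀ k₁ k₂ k₃ k₄ k₅ : ℕ, (k₀ : ℤ) - k₂ - k₃ + k₅ = a ∧
      (k₁ : ℤ) + k₂ - k₄ - k₅ = b ∧
      k₀ + k₁ + k₂ + k₃ + k₄ + k₅ ≤ (a + b).toNat + (-a).toNat + (-b).toNat := by
    by_cases ha : 0 ≤ a <;> by_cases hb : 0 ≤ b
    · exact ⟨a.toNat, b.toNat, 0, 0, 0, 0, by omega, by omega, by omega⟩
    · exact ⟨(a + b).toNat, 0, 0, 0, (-(a + b)).toNat, min a.toNat (-b).toNat,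
        by omega, by omega, by omega⟩
    · exact ⟨0, (a + b).toNat, min b.toNat (-a).toNat, (-(a + b)).toNat, 0, 0,
        by omega, by omega, by omega⟩
    · exact ⟨0, 0, 0, (-a).toNat, (-b).toNat, 0, by omega, by omega, by omega⟩
  obtain ⟨k₀, k₁, k₂, k₃, k₄, k₅, ha, hb, hk⟩ := exponents
  refine ⟨![k₀, k₁, k₂, k₃, k₄, k₅, 0, 0], ?_, ?_⟩
  · simp only [Fin.sum_univ_eight, genDeg]
    ext <;> simp <;> omega
  · simp only [Fin.sum_univ_eight, numLines]
    simp
    omega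

theorem exists_monDeg_eq (ε : Kind) (α β : ℕ) (d : ℤ × ℤ) : ∃ K : Fin 8 → ℕ,
    monDeg ε ⟨α, β, K⟩ = d ∧ ∑ i, K i ≤ numLines 0 0 (d - prefactorDeg ε α β) := by
  obtain ⟨K, hK, degree_le⟩ := exists_sum_smul_genDeg_eq (d - prefactorDeg ε α β)
  exact ⟨K, by rw [monDeg, hK, add_sub_cancel], degree_le⟩

theorem exists_short_monomial {n Δ : ℕ} (hΔ : Δ ≤ n) (ε : Kind) (d : ℤ × ℤ) :
    ∃ m : MonIdx, m.Admissible Δ ε ∧ monDeg ε m = d ∧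
      m.degree + shift Δ ε ≤ numLines (compDeg n Δ ε.col) (compDeg n Δ ε.row) d := by
  suffices exists_prefactor : ∃ α β : ℕ, MonIdx.Admissible Δ ε ⟨α, β, 0⟩ ∧
      numLines 0 0 (d - prefactorDeg ε α β) + shift Δ ε
        ≤ numLines (compDeg n Δ ε.col) (compDeg n Δ ε.row) d by
    obtain ⟨α, β, hadm, numLines_le⟩ := exists_prefactor
    obtain ⟨K, hK, degree_le⟩ := exists_monDeg_eq ε α β d
    exact ⟨⟨α, β, K⟩, by cases ε <;> exact hadm, hK,
      (Nat.add_le_add_right degree_le _).trans numLines_le⟩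
  obtain ⟨a, b⟩ := d
  cases ε with
  | one => exact ⟨0, 0, ⟨rfl, rfl⟩, by simp [numLines, prefactorDeg, shift, Kind.row, Kind.col]⟩
  | two => exact ⟨0, 0, ⟨rfl, rfl⟩, by simp [numLines, prefactorDeg, shift, Kind.row, Kind.col]⟩
  | plus =>
    refine ⟨min (-a).toNat Δ, min (-b).toNat (Δ - min (-a).toNat Δ), ?_, ?_⟩
    · change min (-a).toNat Δ + min (-b).toNat (Δ - min (-a).toNat Δ) ≤ Δ
      omega
    · simp only [prefactorDeg, numLines, shift, Kind.row, Kind.col, compDeg, Matrix.cons_val_zero,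
        Matrix.cons_val_one, Prod.fst_sub, Prod.snd_sub]
      omega
  | minus =>
    refine ⟨min a.toNat Δ, min b.toNat (Δ - min a.toNat Δ), ?_, ?_⟩
    · change min a.toNat Δ + min b.toNat (Δ - min a.toNat Δ) ≤ Δ
      omega
    · simp only [prefactorDeg, numLines, shift, Kind.row, Kind.col, compDeg, Matrix.cons_val_zero,
        Matrix.cons_val_one, Prod.fst_sub, Prod.snd_sub]
      omega

/-! ### Representative systems -/

theorem hasBidegree_monOp_iff [Nonempty U] {n Δ : ℕ} (hΔ : Δ ≤ n) {ε : Kind} {m : MonIdx}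
    (hm : m.Admissible Δ ε) {d : ℤ × ℤ} : HasBidegree (monOp U n Δ ε m) d ↔ d = monDeg ε m := by
  have tri := isTriOp_monEntry (U := U) hΔ hm
  refine ⟨fun hd => tri.eq_of_mem_bidegree fun i j => ?_, ?_⟩
  · have entry_mem := hd ε.row ε.col i j
    rwa [monOp_eq_single, Matrix.single_apply_same] at entry_mem
  · rintro rfl r c i j
    rw [monOp_eq_single, Matrix.single_apply]
    split_ifs
    · exact tri.mem_bidegree i j
    · exact zero_mem _

theorem sameBidegree_iff [Nonempty U] {n Δ : ℕ} (hΔ : Δ ≤ n) {ε : Kind} {m m' : MonIdx}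
    (hm : m.Admissible Δ ε) (hm' : m'.Admissible Δ ε) :
    SameBidegree U n Δ ε m m' ↔ monDeg ε m = monDeg ε m' := by
  simp only [SameBidegree, hasBidegree_monOp_iff hΔ hm, hasBidegree_monOp_iff hΔ hm',
    exists_eq_left]

theorem isMaximalLength_iff [Nonempty U] {n Δ : ℕ} (hΔ : Δ ≤ n) {ε : Kind} {m : MonIdx} :
    IsMaximalLength U n Δ ε m ↔ m.Admissible Δ ε ∧
      ∀ m' : MonIdx, m'.Admissible Δ ε → monDeg ε m' = monDeg ε m → m.degree ≤ m'.degree := by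
  refine and_congr_right fun hm => ⟨fun hlen m' hm' hdeg => ?_, fun hmin => ?_⟩
  · by_contra! hlt
    have length_le : monLength U n Δ ε m ≤ m'.degree :=
      Nat.sInf_le ⟨m', hm', (sameBidegree_iff hΔ hm' hm).2 hdeg, hlt.le, rfl⟩
    omega
  · have degree_mem : m.degree ∈ {l | ∃ m' : MonIdx, m'.Admissible Δ ε ∧
        SameBidegree U n Δ ε m' m ∧ m'.degree ≤ m.degree ∧ l = m'.degree} :=
      ⟨m, hm, (sameBidegree_iff hΔ hm hm).2 rfl, le_rfl, rfl⟩
    refine le_antisymm (Nat.sInf_le degree_mem) (le_csInf ⟨_, degree_mem⟩ ?_)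
    rintro _ ⟨m', hm', hsame, -, rfl⟩
    exact hmin m' hm' ((sameBidegree_iff hΔ hm' hm).1 hsame)

theorem IsRepresentativeSystem.exists_mem_degree_le [Nonempty U] {n Δ : ℕ} (hΔ : Δ ≤ n)
    {ε : Kind} {S : Set MonIdx} (hS : IsRepresentativeSystem U n Δ ε S) {m : MonIdx}
    (hm : m.Admissible Δ ε) :
    ∃ m' ∈ S, m'.Admissible Δ ε ∧ monDeg ε m' = monDeg ε m ∧ m'.degree ≤ m.degree := by
  let A : Set MonIdx := {m' | m'.Admissible Δ ε ∧ monDeg ε m' = monDeg ε m}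
  let m₀ := Function.argminOn MonIdx.degree A ⟨m, hm, rfl⟩
  obtain ⟨hm₀, hdeg₀⟩ : m₀ ∈ A := Function.argminOn_mem _ _ _
  have m₀_max : IsMaximalLength U n Δ ε m₀ := (isMaximalLength_iff hΔ).2
    ⟨hm₀, fun m' hm' hdeg => Function.argminOn_le _ A ⟨hm', hdeg.trans hdeg₀⟩⟩
  obtain ⟨m', ⟨hm'S, hsame⟩, -⟩ := hS.2 m₀ m₀_max
  obtain ⟨hm', hmin⟩ := (isMaximalLength_iff hΔ).1 (hS.1 m' hm'S)
  have hdeg := ((sameBidegree_iff hΔ hm' hm₀).1 hsame).trans hdeg₀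
  exact ⟨m', hm'S, hm', hdeg, hmin m hm hdeg.symm⟩

/-! ### Spanning -/

theorem single_mem_span_of_mem_bidegree [Nonempty U] {n Δ k l : ℕ} (hΔ : Δ ≤ n) {ε : Kind}
    {S : Kind → Set MonIdx} (hS : IsRepresentativeSystem U n Δ ε (S ε)) (hlk : l ≤ k)
    (hl : l ≤ compDeg n Δ ε.col) {d : ℤ × ℤ} {E : Module.End ℂ (Smooth U)}
    (hE : E ∈ orderLE U l) (hEd : E ∈ bidegree U d)
    (hmap : MapsTri (compDeg n Δ ε.col) (compDeg n Δ ε.row) E) :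
    Matrix.single ε.row ε.col E ∈ Submodule.span ℂ (spanningMonomials U n Δ k S) := by
  obtain ⟨p, hp, symbol⟩ := exists_isSymbol hE hEd
  rcases eq_or_ne p 0 with rfl | p_ne_zero
  · rw [symbol.eq_of_symbol_eq hE (zero_mem (orderLE U 0)) .zero, Matrix.single_zero]
    exact zero_mem _
  obtain ⟨m₁, hm₁, rfl, short₁⟩ := exists_short_monomial hΔ ε d
  obtain ⟨m, hmS, hm, monDeg_eq, degree_le⟩ := hS.exists_mem_degree_le hΔ hm₁
  rw [← monDeg_eq] at symbol short₁
  have tri := isTriOp_monEntry (U := U) hΔ hm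
  obtain ⟨p₀, hp₀, symbol₀⟩ := exists_isSymbol tri.mem_orderLE tri.mem_bidegree
  have p₀_ne_zero : p₀ ≠ 0 := by
    rintro rfl
    obtain ⟨N, hN⟩ := tri.apply_ne_zero
    exact hN N N le_rfl le_rfl (by rw [symbol₀.apply_mono, map_zero, zero_smul])
  obtain ⟨r, rfl, hr⟩ := symbol₀.exists_eq_mul_of_totalDegree_le_numLines tri.mapsTri p₀_ne_zero
    (by omega) symbol hmap p_ne_zero (hp.trans hl)
  have span_le : Submodule.span ℂ {G | ∃ i j, i + j ≤ r.totalDegree ∧ G = monEntry U n Δ ε m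
      * genJ U (compDeg n Δ ε.col) 6 ^ i * genJ U (compDeg n Δ ε.col) 7 ^ j}
        ≤ (Submodule.span ℂ (spanningMonomials U n Δ k S)).comap
          (Matrix.singleLinearMap ℂ ε.row ε.col) := by
    refine Submodule.span_le.2 ?_
    rintro _ ⟨i, j, hij, rfl⟩
    exact Submodule.subset_span
      ⟨ε, m, i, j, hmS, by omega, (monOp_mul_eq_single n Δ ε m i j).symm⟩
  exact span_le (symbol₀.mem_span_mul_genJ tri.mem_orderLE symbol hE _ le_rfl)

theorem single_mem_span [Nonempty U] {n Δ k l : ℕ} (hΔ : Δ ≤ n) {ε : Kind}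
    {S : Kind → Set MonIdx} (hS : IsRepresentativeSystem U n Δ ε (S ε)) (hlk : l ≤ k)
    (hl : l ≤ compDeg n Δ ε.col) {E : Module.End ℂ (Smooth U)} (hE : E ∈ orderLE U l)
    (hmap : MapsTri (compDeg n Δ ε.col) (compDeg n Δ ε.row) E) :
    Matrix.single ε.row ε.col E ∈ Submodule.span ℂ (spanningMonomials U n Δ k S) := by
  obtain ⟨F, G, rfl, hG⟩ := exists_homogeneous_decomposition hl hE hmap
  rw [← Matrix.singleAddMonoidHom_apply, map_sum]
  refine sum_mem fun d hd => ?_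
  obtain ⟨order, bideg, maps⟩ := hG d hd
  exact single_mem_span_of_mem_bidegree hΔ hS hlk hl order bideg maps

theorem PreservesModule.mapsTri {n Δ : ℕ} {T : MatOp U} (h : PreservesModule U n Δ T)
    (r c : Fin 2) : MapsTri (compDeg n Δ c) (compDeg n Δ r) (T r c) := by
  intro f hf
  have act_single : act T (Pi.single c f) r = T r c f := by
    rw [act, Finset.sum_eq_single c (fun c' _ hc' => by rw [Pi.single_eq_of_ne hc', map_zero])
      (by simp), Pi.single_eq_same]
  rw [← act_single]
  refine h _ (fun c' => ?_) r
  rcases eq_or_ne c' c with rfl | hc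
  · rwa [Pi.single_eq_same]
  · rw [Pi.single_eq_of_ne hc]
    exact zero_mem _

end TriangularQES

end

theorem mainTheorem7 (U : TopologicalSpace.Opens (ℂ × ℂ)) (n Δ k : ℕ) (hΔ : Δ ≤ n)
    (S : TriangularQES.Kind → Set TriangularQES.MonIdx)
    (hS : ∀ ε, TriangularQES.IsRepresentativeSystem U n Δ ε (S ε))
    (T : TriangularQES.MatOp U)
    (hT : TriangularQES.InDistinguishedComplement U n Δ T)
    (hk : TriangularQES.MatHasOrderLE U k T) :
    T ∈ Submodule.span ℂ (TriangularQES.spanningMonomials U n Δ k S) := by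
  open TriangularQES in
  rcases isEmpty_or_nonempty U with hU | hU
  · have T_eq_zero : T = 0 := by
      ext r c f z
      exact hU.elim z
    rw [T_eq_zero]
    exact zero_mem _
  rw [Matrix.matrix_eq_sum_single T]
  refine sum_mem fun r _ => sum_mem fun c _ => ?_
  obtain ⟨ε, rfl, rfl⟩ := Kind.exists_row_eq_col_eq r c
  have hmap := hT.1.mapsTri ε.row ε.col
  rcases le_total k (compDeg n Δ ε.col) with h | h
  · exact single_mem_span hΔ (hS ε) le_rfl h (hk _ _) hmap
  · exact single_mem_span hΔ (hS ε) h le_rfl (hT.2 _ _) hmap
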